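/- **Theorem (Stability).** Let $N\ge 1$, $0<\alpha<1$ and $1\le p\le\infty$. Consider the homogeneous problem $$u_t(x,t)-\Delta_x D_{0+,t}^{1-\alpha}u(x,t)=0,\quad x\in\mathbb R^N,\ t>0,\qquad u(x,0)=u_0(x),\quad x\in\mathbb R^N, \qquad (1)$$ where $u_0\in L^p(\mathbb R^N)$ is real-valued and $D_{0+,t}^{1-\alpha}f(t)=\frac{d}{dt}I_{0+}^{\alpha}f(t)$, with $I_{0+}^{\alpha}f(t)=\frac1{\Gamma(\alpha)}\int_0^t(t-s)^{\alpha-1}f(s)\,ds$, is the Riemann–Liouville derivative of order $1-\alpha$. A solution of (1) is a function $u$ with $u(\cdot,t)\in L^p(\mathbb R^N)$ for every $t>0$ and $\sup_{0<t\le T}\|u(\cdot,t)\|_{L^p}<\infty$ for every $T>0$, which satisfies the equation and the initial condition in the sense of distributions in $x$: for every $\psi\in C_c^\infty(\mathbb R^N)$, with $U_\psi(t)=\int_{\mathbb R^N}u(x,t)\psi(x)\,dx$, the derivatives $U_\psi'(t)$ and $D_{0+,t}^{1-\alpha}U_{\Delta\psi}(t)$ exist and are equal for every $t>0$, and $U_\psi(t)\to\int_{\mathbb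 R^N}u_0\psi\,dx$ as $t\to0^+$. Let $E_{\alpha,1}(z)=\sum_{k\ge0}z^k/\Gamma(\alpha k+1)$. Then for every $t>0$ the Green function $$G(x,t)=\frac1{(2\pi)^N}\int_{\mathbb R^N}e^{-i\langle x,\xi\rangle}E_{\alpha,1}(-|\xi|^2t^\alpha)\,d\xi ,$$ understood as a Fourier integral in the sense of tempered distributions, is a real function in $L^1(\mathbb R^N)$. If $u_1,u_2$ are solutions of (1) with initial data $u_0^{(1)},u_0^{(2)}\in L^p(\mathbb R^N)$, then for every $t>0$ $$\|u_1(\cdot,t)-u_2(\cdot,t)\|_{L^p}\le\|G(\cdot,t)\|_{L^1}\,\|u_0^{(1)}-u_0^{(2)}\|_{L^p}\le\|u_0^{(1)}-u_0^{(2)}\|_{L^p}.$$ In particular solutions are stable: for every solution $u_1$ with data $u_0^{(1)}\in L^p(\mathbb R^N)$ and every $\varepsilon>0$ there is $\delta>0$ such that every solution $u_2$ with data $u_0^{(2)}\in L^p(\mathbb R^N)$ and $\|u_0^{(1)}-u_0^{(2)}\|_{L^p}<\delta$ satisfies $\|u_1(\cdot,t)-u_2(\cdot,t)\|_{L^p}<\varepsilon$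 for all $t>0$. -/

import Mathlib

open MeasureTheory Filter Topology
open scoped ENNReal NNReal ContDiff Laplacian

noncomputable section

/-- The Mittag-Leffler function `E_{α,1}(z) = ∑ k, z ^ k / Γ(α k + 1)`. -/
def mittagLeffler (α : ℝ) (z : ℂ) : ℂ :=
  ∑' k : ℕ, z ^ k / (Real.Gamma (α * k + 1) : ℂ)

/-- `g` is (a representative of) the Green function `G(·, t)`: the integrable function
`(2π)^{-N} ∫ e^{-i⟨x,ξ⟩} E_{α,1}(-|ξ|² t^α) dξ`.
The symbol only decays like `|ξ|^{-2}`, so the integral is an (inverse) Fourier transform in the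
sense of tempered distributions: it is paired with an arbitrary Schwartz function. This determines
`g` up to a null set. -/
def IsGreenFunction {N : ℕ} (α t : ℝ) (g : EuclideanSpace ℝ (Fin N) → ℝ) : Prop :=
  Integrable g volume ∧
    ∀ φ : SchwartzMap (EuclideanSpace ℝ (Fin N)) ℂ,
      ∫ x, (g x : ℂ) * φ x =
        (1 / (2 * (Real.pi : ℂ)) ^ N) *
          ∫ ξ : EuclideanSpace ℝ (Fin N),
            mittagLeffler α ((-(‖ξ‖ ^ 2 * t ^ α) : ℝ) : ℂ) *
              ∫ x : EuclideanSpace ℝ (Fin N),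
                Complex.exp (-Complex.I * ((inner ℝ x ξ : ℝ) : ℂ)) * φ x

/-- The left Riemann-Liouville integral `I_{0+}^β f (t)` of order `β`. -/
def rlIntegral (β : ℝ) (f : ℝ → ℝ) (t : ℝ) : ℝ :=
  (1 / Real.Gamma β) * ∫ s in (0 : ℝ)..t, (t - s) ^ (β - 1) * f s

/-- The left Riemann-Liouville derivative `D_{0+}^β f (t) = d/dt I_{0+}^{1-β} f (t)` of order
`0 < β < 1` exists at `t` and equals `d`. -/
def HasRLDerivAt (β : ℝ) (f : ℝ → ℝ) (d t : ℝ) : Prop :=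
  HasDerivAt (rlIntegral (1 - β) f) d t

/-- The pairing `t ↦ ∫ u(x,t) ψ(x) dx`. -/
def pairing {N : ℕ} (u : ℝ → EuclideanSpace ℝ (Fin N) → ℝ)
    (ψ : EuclideanSpace ℝ (Fin N) → ℝ) (t : ℝ) : ℝ :=
  ∫ x, u t x * ψ x

/-- `u` is an `L^p` solution of `u_t - Δ_x D_{0+,t}^{1-α} u = 0` for `t > 0`, `u(·, 0) = u₀`:
`u ∈ L^∞_loc([0,∞); L^p)`, and the equation and the initial condition hold in the sense of
distributions in `x`. Only the values of `u` at times `t > 0` matter. -/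
structure IsSolution {N : ℕ} (α : ℝ) (p : ℝ≥0∞) (u₀ : EuclideanSpace ℝ (Fin N) → ℝ)
    (u : ℝ → EuclideanSpace ℝ (Fin N) → ℝ) : Prop where
  memLp : ∀ t : ℝ, 0 < t → MemLp (u t) p volume
  locallyBounded : ∀ T : ℝ, ∃ C : ℝ≥0, ∀ t : ℝ, 0 < t → t ≤ T → eLpNorm (u t) p volume ≤ C
  equation : ∀ ψ : EuclideanSpace ℝ (Fin N) → ℝ, ContDiff ℝ ∞ ψ → HasCompactSupport ψ →
    ∀ t : ℝ, 0 < t →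
      ∃ d : ℝ, HasDerivAt (pairing u ψ) d t ∧ HasRLDerivAt (1 - α) (pairing u (Δ ψ)) d t
  initial : ∀ ψ : EuclideanSpace ℝ (Fin N) → ℝ, ContDiff ℝ ∞ ψ → HasCompactSupport ψ →
    Tendsto (pairing u ψ) (𝓝[>] 0) (𝓝 (∫ x, u₀ x * ψ x))

end

/-! Two facts carry the theorem: G(·,t) is a probability density, and every solution satisfies u(t)
= G(·,t) * u₀. Young's inequality then gives the estimate with constant ‖G‖₁ = 1.

The density. By Pollard's theorem (`exists_measure_mittagLeffler_eq_integral_exp`), E_{α,1}(x) = ∫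
exp(xm) dM(m) for a probability law M on (0,∞). Hence E_{α,1}(-|ξ|²t^α) is an average of heat
symbols exp(-t^α m|ξ|²), and G is the same average of heat kernels, `subordinatedKernel`. The law M
is that of a multiple of S^(-α), with S one-sided α-stable: exp(-S) is a weak limit point of
explicit laws on [0,1], and the moments of M are n!/Γ(αn+1), which are summed against the
exponential series.

The representation. Testing with φ and integrating in time gives ⟨u(t),φ⟩ = ⟨u₀,φ⟩ + I^α⟨u,Δφ⟩(t)
(`IsSolution.rePairing_eq`). Iterating along φ, Δφ, Δ²φ, … produces the series ∑ t^{αn}/Γ(αn+1)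
⟨u₀,Δⁿφ⟩ (`tendsto_sum_of_hierarchy`), provided ‖Δⁿφ‖_q grows at most geometrically. Bandlimited
Schwartz functions have this property (`exists_eLpNorm_iteratedLaplacian_le`), and for them the same
series is the pairing of u₀ with φ averaged against G (`hasSum_iteratedLaplacian_div_Gamma`). They
also determine an L^p function for every p, including p = ∞ (`ae_eq_zero_of_rePairing_bandlimited`),
so both sides of u(t) = G(·,t) * u₀ agree almost everywhere. -/

/-! ### Growth of Γ and convergence of the Mittag-Leffler series -/

/-- Keep only the part x > A of Euler's integral, where x^y ≥ A^y. Since A is free, this replaces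
Stirling's formula. -/
theorem rpow_mul_exp_neg_le_Gamma {A y : ℝ} (hA : 0 < A) (hy : 0 ≤ y) :
    A ^ y * Real.exp (-A) ≤ Real.Gamma (y + 1) := by
  have hint : IntegrableOn (fun x : ℝ => Real.exp (-x) * x ^ (y + 1 - 1)) (Set.Ioi 0) :=
    Real.GammaIntegral_convergent (by linarith)
  rw [Real.Gamma_eq_integral (by linarith)]
  have hsub : Set.Ioi A ⊆ Set.Ioi (0 : ℝ) := Set.Ioi_subset_Ioi hA.le
  calc A ^ y * Real.exp (-A) = ∫ x in Set.Ioi A, A ^ y * Real.exp (-x) := by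
        rw [integral_const_mul, integral_exp_neg_Ioi]
    _ ≤ ∫ x in Set.Ioi A, Real.exp (-x) * x ^ (y + 1 - 1) := by
        refine setIntegral_mono_on ((integrableOn_exp_neg_Ioi A).const_mul _)
          (hint.mono_set hsub) measurableSet_Ioi fun x hx => ?_
        rw [mul_comm, add_sub_cancel_right]
        gcongr
        exact (Set.mem_Ioi.1 hx).le
    _ ≤ ∫ x in Set.Ioi (0 : ℝ), Real.exp (-x) * x ^ (y + 1 - 1) := by
        refine setIntegral_mono_set hint ?_ hsub.eventuallyLE
        filter_upwards [ae_restrict_mem measurableSet_Ioi] with x hx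
        have : 0 < x := hx
        positivity

theorem Gamma_mul_nat_add_one_pos {α : ℝ} (hα : 0 ≤ α) (n : ℕ) :
    0 < Real.Gamma (α * n + 1) := Real.Gamma_pos_of_pos (by positivity)

theorem summable_pow_div_Gamma {α : ℝ} (hα : 0 < α) (x : ℝ) :
    Summable fun n : ℕ => x ^ n / Real.Gamma (α * n + 1) := by
  set B : ℝ := 2 * (|x| + 1) with hB
  have hBpos : 0 < B := by positivity
  -- With this A, A^(αn) = Bⁿ, so Γ(αn+1) dominates a geometric sequence of ratio B > |x|.
  set A : ℝ := B ^ α⁻¹ with hA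
  have hApos : 0 < A := by positivity
  have hAB : A ^ α = B := Real.rpow_inv_rpow hBpos.le hα.ne'
  have hr : |x| / B < 1 := by
    rw [div_lt_one hBpos]; have := abs_nonneg x; linarith
  refine Summable.of_norm_bounded (g := fun n : ℕ => Real.exp A * (|x| / B) ^ n)
    ((summable_geometric_of_lt_one (by positivity) hr).mul_left _) fun n => ?_
  have hG := rpow_mul_exp_neg_le_Gamma (y := α * n) hApos (by positivity)
  rw [Real.rpow_mul hApos.le, hAB, Real.rpow_natCast] at hG
  have hGp := Gamma_mul_nat_add_one_pos hα.le n
  rw [norm_div, norm_pow, Real.norm_eq_abs, Real.norm_of_nonneg hGp.le, div_pow,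
    div_le_iff₀ hGp]
  calc |x| ^ n = Real.exp A * (|x| ^ n / B ^ n) * (B ^ n * Real.exp (-A)) := by
        rw [Real.exp_neg]; field_simp
    _ ≤ _ := by gcongr

theorem tendsto_pow_div_Gamma {α : ℝ} (hα : 0 < α) (x : ℝ) :
    Tendsto (fun n : ℕ => x ^ n / Real.Gamma (α * n + 1)) atTop (𝓝 0) :=
  (summable_pow_div_Gamma hα x).tendsto_atTop_zero

theorem hasSum_mittagLeffler_ofReal {α : ℝ} (hα : 0 < α) (x : ℝ) :
    HasSum (fun n : ℕ => ((x ^ n / Real.Gamma (α * n + 1) : ℝ) : ℂ)) (mittagLeffler α x) := by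
  have h : Summable (fun n : ℕ => ((x ^ n / Real.Gamma (α * n + 1) : ℝ) : ℂ)) :=
    Complex.ofRealCLM.summable (summable_pow_div_Gamma hα x)
  convert h.hasSum using 1
  simp [mittagLeffler]

/-! ### One-sided stable laws and Pollard's theorem -/

/-- The integrand is at most 1 near 0 and at most s v^(-1/α) at infinity; the latter is integrable
because α < 1. -/
theorem integrableOn_one_sub_exp_neg_mul_rpow {α s : ℝ} (hα0 : 0 < α) (hα1 : α < 1) (hs : 0 < s) :
    IntegrableOn (fun v : ℝ => 1 - Real.exp (-(s * |v| ^ (-α⁻¹)))) (Set.Ioi 0) := by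
  have hm : Measurable (fun v : ℝ => 1 - Real.exp (-(s * |v| ^ (-α⁻¹)))) := by fun_prop
  rw [← Set.Ioc_union_Ioi_eq_Ioi zero_le_one]
  refine IntegrableOn.union ?_ ?_
  · refine Measure.integrableOn_of_bounded (M := 1) (by simp) hm.aestronglyMeasurable ?_
    refine ae_of_all _ fun v => ?_
    have h1 : Real.exp (-(s * |v| ^ (-α⁻¹))) ≤ 1 := Real.exp_le_one_iff.2 (by
      have : 0 ≤ s * |v| ^ (-α⁻¹) := by positivity
      linarith)
    have h2 := Real.exp_pos (-(s * |v| ^ (-α⁻¹)))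
    rw [Real.norm_eq_abs, abs_le]
    constructor <;> linarith
  · have hα : -α⁻¹ < -1 := by
      have := (one_lt_inv₀ hα0).2 hα1
      linarith
    refine Integrable.mono' ((integrableOn_Ioi_rpow_of_lt hα one_pos).const_mul s)
      hm.aestronglyMeasurable ?_
    filter_upwards [ae_restrict_mem measurableSet_Ioi] with v hv
    have hv0 : (0 : ℝ) < v := lt_trans one_pos hv
    rw [abs_of_pos hv0]
    have h1 : Real.exp (-(s * v ^ (-α⁻¹))) ≤ 1 := Real.exp_le_one_iff.2 (by
      have : 0 ≤ s * v ^ (-α⁻¹) := by positivity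
      linarith)
    have h2 := Real.add_one_le_exp (-(s * v ^ (-α⁻¹)))
    rw [Real.norm_eq_abs, abs_of_nonneg (by linarith)]
    linarith

/-- The constant `Γ(1 - α)`, as the integral arising from the Pareto tails `v ^ (-1/α)`. -/
noncomputable def stableConst (α : ℝ) : ℝ :=
  ∫ v in Set.Ioi (0 : ℝ), (1 - Real.exp (-(1 * |v| ^ (-α⁻¹))))

/-- Scaling v by s^(-α) absorbs s; this is the source of the exponent s^α of the stable law. -/
theorem integral_one_sub_exp_neg_mul_rpow {α s : ℝ} (hα0 : 0 < α) (hs : 0 < s) :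
    ∫ v in Set.Ioi (0 : ℝ), (1 - Real.exp (-(s * |v| ^ (-α⁻¹)))) = stableConst α * s ^ α := by
  have hb : 0 < s ^ (-α) := by positivity
  have h := integral_comp_mul_left_Ioi
    (fun v : ℝ => 1 - Real.exp (-(1 * |v| ^ (-α⁻¹)))) 0 hb
  rw [mul_zero] at h
  rw [stableConst, mul_comm, ← inv_inv (s ^ α), ← Real.rpow_neg hs.le, ← smul_eq_mul, ← h]
  refine setIntegral_congr_fun measurableSet_Ioi fun v hv => ?_
  rw [abs_mul, Real.mul_rpow (abs_nonneg _) (abs_nonneg _), abs_of_pos hb, ← Real.rpow_mul hs.le,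
    neg_mul_neg, mul_inv_cancel₀ hα0.ne', Real.rpow_one, one_mul]

theorem stableConst_pos {α : ℝ} (hα0 : 0 < α) (hα1 : α < 1) : 0 < stableConst α := by
  rw [stableConst]
  refine (setIntegral_pos_iff_support_of_nonneg_ae ?_
    (integrableOn_one_sub_exp_neg_mul_rpow hα0 hα1 one_pos)).2 ?_
  · refine ae_of_all _ fun v => ?_
    have : Real.exp (-(1 * |v| ^ (-α⁻¹))) ≤ 1 := Real.exp_le_one_iff.2 (by
      have : 0 ≤ 1 * |v| ^ (-α⁻¹) := by positivity
      linarith)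
    simpa using this
  · refine lt_of_lt_of_le (b := volume (Set.Ioi (0 : ℝ))) (by simp) (measure_mono fun v hv => ?_)
    refine ⟨?_, hv⟩
    have hv : 0 < v := hv
    have : 0 < |v| ^ (-α⁻¹) := by positivity
    have h1 : Real.exp (-(1 * |v| ^ (-α⁻¹))) < 1 := Real.exp_lt_one_iff.2 (by linarith)
    exact (sub_pos.2 h1).ne'

/-- The uniform probability measure on `(0, n]`. -/
noncomputable def uniformIoc (n : ℕ) : Measure ℝ :=
  (n : ℝ≥0∞)⁻¹ • volume.restrict (Set.Ioc (0 : ℝ) n)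

theorem isProbabilityMeasure_uniformIoc {n : ℕ} (hn : n ≠ 0) :
    IsProbabilityMeasure (uniformIoc n) := by
  constructor
  simp only [uniformIoc, Measure.smul_apply, Measure.restrict_apply_univ, Real.volume_Ioc,
    sub_zero, ENNReal.ofReal_natCast, smul_eq_mul]
  exact ENNReal.inv_mul_cancel (by simpa using hn) (by simp)

/-- `exp (-∑ i, |v i| ^ (-1/α))` as a point of the unit interval. -/
noncomputable def expNegSum (α : ℝ) (n : ℕ) (v : Fin n → ℝ) : Set.Icc (0 : ℝ) 1 :=
  ⟨Real.exp (-∑ i, |v i| ^ (-α⁻¹)), (Real.exp_pos _).le, Real.exp_le_one_iff.2 (by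
    have : 0 ≤ ∑ i, |v i| ^ (-α⁻¹) := Finset.sum_nonneg fun i _ => by positivity
    linarith)⟩

theorem measurable_expNegSum (α : ℝ) (n : ℕ) : Measurable (expNegSum α n) := by
  refine Measurable.subtype_mk ?_
  fun_prop

/-- The coordinates are independent, so the Laplace transform of the sum is an n-th power. The form
1 + -(…) prepares for the limit (1 + aₙ)ⁿ → exp(lim n aₙ). -/
theorem integral_expNegSum_rpow {α s : ℝ} (hα0 : 0 < α) (hα1 : α < 1) (hs : 0 < s) {n : ℕ}
    (hn : n ≠ 0) :
    ∫ v, ((expNegSum α n v : ℝ)) ^ s ∂(Measure.pi fun _ : Fin n => uniformIoc n) =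
      (1 + -((n : ℝ)⁻¹ * ∫ v in (0 : ℝ)..n, (1 - Real.exp (-(s * |v| ^ (-α⁻¹)))))) ^ n := by
  have := isProbabilityMeasure_uniformIoc hn
  have h1 : ∀ v : Fin n → ℝ, ((expNegSum α n v : ℝ)) ^ s =
      ∏ i, Real.exp (-(s * |v i| ^ (-α⁻¹))) := fun v => by
    rw [expNegSum, ← Real.exp_mul, ← Real.exp_sum, neg_mul, Finset.sum_mul, Finset.sum_neg_distrib]
    simp only [mul_comm]
  simp_rw [h1]
  rw [integral_fintype_prod_eq_prod (f := fun (_ : Fin n) (x : ℝ) =>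
    Real.exp (-(s * |x| ^ (-α⁻¹))))]
  rw [Finset.prod_const, Finset.card_univ, Fintype.card_fin]
  congr 1
  have hn' : (0 : ℝ) < n := by positivity
  have hint : Integrable (fun v : ℝ => 1 - Real.exp (-(s * |v| ^ (-α⁻¹)))) (uniformIoc n) := by
    refine Integrable.smul_measure ?_ (by simpa using hn)
    exact (integrableOn_one_sub_exp_neg_mul_rpow hα0 hα1 hs).mono_set Set.Ioc_subset_Ioi_self
  have h2 : ∫ v, Real.exp (-(s * |v| ^ (-α⁻¹))) ∂(uniformIoc n) =
      1 - ∫ v, (1 - Real.exp (-(s * |v| ^ (-α⁻¹)))) ∂(uniformIoc n) := by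
    have h3 : ∫ v, (1 - (1 - Real.exp (-(s * |v| ^ (-α⁻¹))))) ∂(uniformIoc n) = _ :=
      integral_sub (integrable_const (1 : ℝ)) hint
    simpa using h3
  rw [h2, uniformIoc, integral_smul_measure, intervalIntegral.integral_of_le hn'.le]
  simp [sub_eq_add_neg]

theorem tendsto_integral_expNegSum_rpow {α s : ℝ} (hα0 : 0 < α) (hα1 : α < 1) (hs : 0 < s) :
    Tendsto (fun n : ℕ => ∫ v, ((expNegSum α n v : ℝ)) ^ s
      ∂(Measure.pi fun _ : Fin n => uniformIoc n)) atTop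
      (𝓝 (Real.exp (-(stableConst α * s ^ α)))) := by
  have h1 : Tendsto (fun n : ℕ => (1 + -((n : ℝ)⁻¹ *
      ∫ v in (0 : ℝ)..n, (1 - Real.exp (-(s * |v| ^ (-α⁻¹)))))) ^ n) atTop
      (𝓝 (Real.exp (-(stableConst α * s ^ α)))) := by
    apply Real.tendsto_one_add_pow_exp_of_tendsto
    have h2 := (intervalIntegral_tendsto_integral_Ioi 0
      (integrableOn_one_sub_exp_neg_mul_rpow hα0 hα1 hs) tendsto_natCast_atTop_atTop).neg
    rw [integral_one_sub_exp_neg_mul_rpow hα0 hs] at h2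
    refine h2.congr' ?_
    filter_upwards [eventually_ne_atTop 0] with n hn
    have hn' : (n : ℝ) ≠ 0 := by exact_mod_cast hn
    field_simp
  refine h1.congr' ?_
  filter_upwards [eventually_ne_atTop 0] with n hn
  rw [integral_expNegSum_rpow hα0 hα1 hs hn]

/-- A one-sided stable law, transported to the unit interval by `x ↦ exp (-x)`. -/
theorem exists_probabilityMeasure_integral_rpow {α : ℝ} (hα0 : 0 < α) (hα1 : α < 1) :
    ∃ μ : ProbabilityMeasure (Set.Icc (0 : ℝ) 1), ∀ s : ℝ, 0 < s →
      ∫ z, (z : ℝ) ^ s ∂(μ : Measure (Set.Icc (0 : ℝ) 1)) =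
        Real.exp (-(stableConst α * s ^ α)) := by
  have hP : ∀ n : ℕ, IsProbabilityMeasure (Measure.pi fun _ : Fin (n + 1) => uniformIoc (n + 1)) :=
    fun n => by
      have := isProbabilityMeasure_uniformIoc n.succ_ne_zero
      infer_instance
  let m : ℕ → ProbabilityMeasure (Set.Icc (0 : ℝ) 1) := fun n =>
    ⟨(Measure.pi fun _ : Fin (n + 1) => uniformIoc (n + 1)).map (expNegSum α (n + 1)),
      Measure.isProbabilityMeasure_map (measurable_expNegSum α (n + 1)).aemeasurable⟩
  -- Probability measures on the compact interval form a compact space, so no tightness argument is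
  -- needed. A limit along an ultrafilter suffices, since z ↦ z^s is continuous on [0,1] for each s
  -- > 0.
  obtain ⟨μ, -, hμ⟩ := isCompact_univ.ultrafilter_le_nhds ((hyperfilter ℕ).map m) (by simp)
  refine ⟨μ, fun s hs => ?_⟩
  have hμ' : Tendsto m (hyperfilter ℕ) (𝓝 μ) := hμ
  rw [ProbabilityMeasure.tendsto_iff_forall_integral_tendsto] at hμ'
  have hcont : Continuous fun z : Set.Icc (0 : ℝ) 1 => (z : ℝ) ^ s :=
    continuous_subtype_val.rpow_const fun _ => Or.inr hs.le
  have h1 := hμ' (BoundedContinuousFunction.mkOfCompact ⟨_, hcont⟩)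
  simp only [BoundedContinuousFunction.mkOfCompact_apply, ContinuousMap.coe_mk] at h1
  refine tendsto_nhds_unique h1 ?_
  have h2 := ((tendsto_add_atTop_iff_nat 1).2
    (tendsto_integral_expNegSum_rpow hα0 hα1 hs)).mono_left Nat.hyperfilter_le_atTop
  refine h2.congr fun n => ?_
  simp only [m, ProbabilityMeasure.coe_mk]
  rw [integral_map (measurable_expNegSum α (n + 1)).aemeasurable hcont.aestronglyMeasurable]

/-- Letting s → 0 shows that {z ≠ 0} has full mass; letting s → ∞ bounds the mass of {z = 1} by
exp(-C s^α) → 0. -/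
theorem ae_mem_Ioo_of_integral_rpow {α C : ℝ} (hα0 : 0 < α) (hC : 0 < C)
    {μ : Measure (Set.Icc (0 : ℝ) 1)} [IsProbabilityMeasure μ]
    (hμ : ∀ s : ℝ, 0 < s → ∫ z, (z : ℝ) ^ s ∂μ = Real.exp (-(C * s ^ α))) :
    ∀ᵐ z : Set.Icc (0 : ℝ) 1 ∂μ, 0 < (z : ℝ) ∧ (z : ℝ) < 1 := by
  have hle : ∀ (s : ℝ) (z : Set.Icc (0 : ℝ) 1), 0 ≤ s → ‖(z : ℝ) ^ s‖ ≤ 1 := fun s z hs => by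
    rw [Real.norm_of_nonneg (Real.rpow_nonneg z.2.1 _)]
    exact Real.rpow_le_one z.2.1 z.2.2 hs
  have hmeas : ∀ s : ℝ, Measurable (fun z : Set.Icc (0 : ℝ) 1 => (z : ℝ) ^ s) := fun s =>
    measurable_subtype_coe.pow_const s
  have hzero : ∀ᵐ z : Set.Icc (0 : ℝ) 1 ∂μ, (z : ℝ) ≠ 0 := by
    have hS : MeasurableSet {z : Set.Icc (0 : ℝ) 1 | (z : ℝ) ≠ 0} :=
      (measurable_subtype_coe (measurableSet_singleton (0 : ℝ))).compl
    have hseq : Tendsto (fun n : ℕ => ((n : ℝ) + 1)⁻¹) atTop (𝓝 0) := by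
      simpa using tendsto_one_div_add_atTop_nhds_zero_nat (𝕜 := ℝ)
    have h1 : Tendsto (fun n : ℕ => ∫ z, (z : ℝ) ^ (((n : ℝ) + 1)⁻¹) ∂μ) atTop
        (𝓝 (∫ z, Set.indicator {z : Set.Icc (0 : ℝ) 1 | (z : ℝ) ≠ 0} (fun _ => (1 : ℝ)) z ∂μ)) := by
      refine tendsto_integral_of_dominated_convergence (fun _ => 1)
        (fun n => (hmeas _).aestronglyMeasurable) (integrable_const _)
        (fun n => ae_of_all _ fun z => hle _ z (by positivity)) (ae_of_all _ fun z => ?_)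
      by_cases hz : (z : ℝ) = 0
      · have : z ∉ {z : Set.Icc (0 : ℝ) 1 | (z : ℝ) ≠ 0} := fun h => h hz
        rw [Set.indicator_of_notMem this, hz]
        refine tendsto_const_nhds.congr fun n => ?_
        rw [Real.zero_rpow (by positivity)]
      · rw [Set.indicator_of_mem (by exact hz)]
        have := (tendsto_const_nhds (x := (z : ℝ))).rpow hseq (Or.inl hz)
        simpa using this
    have h2 : Tendsto (fun n : ℕ => ∫ z, (z : ℝ) ^ (((n : ℝ) + 1)⁻¹) ∂μ) atTop (𝓝 1) := by
      have h3 : Tendsto (fun n : ℕ => Real.exp (-(C * (((n : ℝ) + 1)⁻¹) ^ α))) atTop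
          (𝓝 (Real.exp (-(C * 0 ^ α)))) :=
        (Real.continuous_exp.tendsto _).comp
          (((hseq.rpow_const (Or.inr hα0.le)).const_mul C).neg)
      rw [Real.zero_rpow hα0.ne', mul_zero, neg_zero, Real.exp_zero] at h3
      refine h3.congr fun n => (hμ _ (by positivity)).symm
    have h4 := tendsto_nhds_unique h1 h2
    rw [integral_indicator_const _ hS, smul_eq_mul, mul_one] at h4
    rw [ae_iff]
    have h5 := probReal_compl_eq_one_sub hS (μ := μ)
    rw [h4, sub_self] at h5
    rw [← measureReal_eq_zero_iff]
    exact h5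
  have hone : ∀ᵐ z : Set.Icc (0 : ℝ) 1 ∂μ, (z : ℝ) ≠ 1 := by
    have hS : MeasurableSet {z : Set.Icc (0 : ℝ) 1 | (z : ℝ) = 1} :=
      measurable_subtype_coe (measurableSet_singleton (1 : ℝ))
    have h1 : ∀ n : ℕ, μ.real {z : Set.Icc (0 : ℝ) 1 | (z : ℝ) = 1} ≤
        Real.exp (-(C * ((n : ℝ) + 1) ^ α)) := fun n => by
      rw [← hμ _ (by positivity), ← mul_one (μ.real _), ← smul_eq_mul,
        ← integral_indicator_const _ hS]
      refine integral_mono ((integrable_const _).indicator hS)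
        (Integrable.of_bound (hmeas _).aestronglyMeasurable 1
          (ae_of_all _ fun z => hle _ z (by positivity))) fun z => ?_
      by_cases hz : (z : ℝ) = 1
      · rw [Set.indicator_of_mem (by exact hz), hz, Real.one_rpow]
      · rw [Set.indicator_of_notMem (by exact hz)]
        exact Real.rpow_nonneg z.2.1 _
    have h2 : Tendsto (fun n : ℕ => Real.exp (-(C * ((n : ℝ) + 1) ^ α))) atTop (𝓝 0) := by
      refine Real.tendsto_exp_neg_atTop_nhds_zero.comp
        (Tendsto.const_mul_atTop hC ((tendsto_rpow_atTop hα0).comp ?_))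
      exact tendsto_atTop_add_const_right _ _ tendsto_natCast_atTop_atTop
    have h3 := ge_of_tendsto' h2 h1
    rw [ae_iff]
    have h4 : μ.real {z : Set.Icc (0 : ℝ) 1 | (z : ℝ) = 1} = 0 := le_antisymm h3 measureReal_nonneg
    rw [measureReal_eq_zero_iff] at h4
    simpa using h4
  filter_upwards [hzero, hone] with z h0 h1
  exact ⟨lt_of_le_of_ne z.2.1 (Ne.symm h0), lt_of_le_of_ne z.2.2 h1⟩

/-- Tonelli for s^(αn-1) z^s: integrating in s first gives Γ(αn)(-log z)^(-αn), integrating in z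
first gives ∫ s^(αn-1) exp(-C s^α) ds = Γ(n)/(α Cⁿ). Extended nonnegative integrals make finiteness
of the moments part of the conclusion. -/
theorem lintegral_neg_log_rpow_pow {α C : ℝ} (hα0 : 0 < α) (hC : 0 < C)
    {μ : Measure (Set.Icc (0 : ℝ) 1)} [IsProbabilityMeasure μ]
    (hμ : ∀ s : ℝ, 0 < s → ∫ z, (z : ℝ) ^ s ∂μ = Real.exp (-(C * s ^ α))) (n : ℕ) :
    ∫⁻ z, ENNReal.ofReal ((C * (-Real.log z) ^ (-α)) ^ n) ∂μ =
      ENNReal.ofReal (n.factorial / Real.Gamma (α * n + 1)) := by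
  -- For n = 0 the weight s^(-1) is not integrable at 0, so this case is separate.
  rcases Nat.eq_zero_or_pos n with rfl | hn
  · simp
  have hn' : (0 : ℝ) < n := by exact_mod_cast hn
  have hαn : 0 < α * n := by positivity
  have hG : 0 < Real.Gamma (α * n) := Real.Gamma_pos_of_pos hαn
  have hae := ae_mem_Ioo_of_integral_rpow hα0 hC hμ
  have hmz : Measurable fun z : Set.Icc (0 : ℝ) 1 => (z : ℝ) := measurable_subtype_coe
  have hswap : ∫⁻ z, (∫⁻ s in Set.Ioi (0 : ℝ),
        ENNReal.ofReal (s ^ (α * n - 1) * (z : ℝ) ^ s)) ∂μ =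
      ∫⁻ s in Set.Ioi (0 : ℝ), (∫⁻ z, ENNReal.ofReal (s ^ (α * n - 1) * (z : ℝ) ^ s) ∂μ) := by
    refine lintegral_lintegral_swap ?_
    refine Measurable.aemeasurable ?_
    refine ENNReal.measurable_ofReal.comp ?_
    refine Measurable.mul (measurable_snd.pow_const _) ?_
    exact (hmz.comp measurable_fst).pow measurable_snd
  have hleft : ∫⁻ z, (∫⁻ s in Set.Ioi (0 : ℝ),
        ENNReal.ofReal (s ^ (α * n - 1) * (z : ℝ) ^ s)) ∂μ =
      ENNReal.ofReal (Real.Gamma (α * n) * (C ^ n)⁻¹) *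
        ∫⁻ z, ENNReal.ofReal ((C * (-Real.log z) ^ (-α)) ^ n) ∂μ := by
    rw [← lintegral_const_mul _ (by fun_prop)]
    refine lintegral_congr_ae ?_
    filter_upwards [hae] with z hz
    have hl : 0 < -Real.log z := by
      have := Real.log_neg hz.1 hz.2
      linarith
    have h1 : ∀ s : ℝ, s ^ (α * n - 1) * (z : ℝ) ^ s =
        s ^ (α * n - 1) * Real.exp (-((-Real.log z) * s)) := fun s => by
      rw [Real.rpow_def_of_pos hz.1, neg_mul, neg_neg]
    have h2 : IntegrableOn (fun s : ℝ => s ^ (α * n - 1) * (z : ℝ) ^ s) (Set.Ioi 0) := by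
      simp_rw [h1]
      have := integrableOn_rpow_mul_exp_neg_mul_rpow (p := 1) (s := α * n - 1)
        (by linarith) one_pos hl
      simpa [Real.rpow_one] using this
    rw [← ofReal_integral_eq_lintegral_ofReal h2, ← ENNReal.ofReal_mul (by positivity)]
    · congr 1
      simp_rw [h1]
      rw [Real.integral_rpow_mul_exp_neg_mul_Ioi hαn hl, mul_pow, ← Real.rpow_natCast (_ ^ (-α)),
        ← Real.rpow_mul hl.le, one_div, Real.inv_rpow hl.le, neg_mul, Real.rpow_neg hl.le]
      field_simp
    · filter_upwards [ae_restrict_mem measurableSet_Ioi] with s hs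
      have hs : 0 < s := hs
      have := hz.1
      simp only [Pi.zero_apply]
      positivity
  have hright : ∫⁻ s in Set.Ioi (0 : ℝ),
        (∫⁻ z, ENNReal.ofReal (s ^ (α * n - 1) * (z : ℝ) ^ s) ∂μ) =
      ENNReal.ofReal ((C ^ n)⁻¹ * (1 / α) * Real.Gamma n) := by
    have h1 : IntegrableOn (fun s : ℝ => s ^ (α * n - 1) * Real.exp (-C * s ^ α)) (Set.Ioi 0) :=
      integrableOn_rpow_mul_exp_neg_mul_rpow (by linarith) hα0 hC
    have h2 := integral_rpow_mul_exp_neg_mul_rpow (q := α * n - 1) hα0 (by linarith) hC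
    rw [sub_add_cancel, neg_div, mul_div_cancel_left₀ _ hα0.ne',
      Real.rpow_neg hC.le, Real.rpow_natCast] at h2
    rw [← h2, ofReal_integral_eq_lintegral_ofReal h1]
    · refine setLIntegral_congr_fun measurableSet_Ioi fun s hs => ?_
      have hs : 0 < s := hs
      have hint : Integrable (fun z : Set.Icc (0 : ℝ) 1 => (z : ℝ) ^ s) μ := by
        refine Integrable.of_bound (hmz.pow_const s).aestronglyMeasurable 1
          (ae_of_all _ fun z => ?_)
        rw [Real.norm_of_nonneg (Real.rpow_nonneg z.2.1 _)]
        exact Real.rpow_le_one z.2.1 z.2.2 hs.le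
      rw [← ofReal_integral_eq_lintegral_ofReal (hint.const_mul _), integral_const_mul, hμ s hs,
        neg_mul]
      refine ae_of_all _ fun z => ?_
      have := Real.rpow_nonneg z.2.1 s
      simp only [Pi.zero_apply]
      positivity
    · filter_upwards [ae_restrict_mem measurableSet_Ioi] with s hs
      have hs : 0 < s := hs
      simp only [Pi.zero_apply]
      positivity
  rw [hleft, hright] at hswap
  have hpos : 0 < Real.Gamma (α * n) * (C ^ n)⁻¹ := by positivity
  have h3 : (C ^ n)⁻¹ * (1 / α) * Real.Gamma n =
      Real.Gamma (α * n) * (C ^ n)⁻¹ * (n.factorial / Real.Gamma (α * n + 1)) := by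
    rw [Real.Gamma_add_one hαn.ne', ← Real.Gamma_nat_eq_factorial, Real.Gamma_add_one hn'.ne']
    field_simp
  rw [h3, ENNReal.ofReal_mul hpos.le] at hswap
  exact (ENNReal.mul_right_inj (by simpa using hpos) ENNReal.ofReal_ne_top).1 hswap

/-- The Mittag-Leffler function is the moment generating function of a probability law on
`(0, ∞)` (Pollard's theorem). -/
theorem exists_measure_mittagLeffler_eq_integral_exp {α : ℝ} (hα0 : 0 < α) (hα1 : α < 1) :
    ∃ M : Measure ℝ, IsProbabilityMeasure M ∧ (∀ᵐ m ∂M, 0 < m) ∧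
      ∀ x : ℝ, mittagLeffler α x = ((∫ m, Real.exp (x * m) ∂M : ℝ) : ℂ) := by
  obtain ⟨μ, hμ⟩ := exists_probabilityMeasure_integral_rpow hα0 hα1
  have hC := stableConst_pos hα0 hα1
  set C := stableConst α
  -- With z = exp(-S) this is C S^(-α); the factor C cancels the stable constant in the moments.
  set X : Set.Icc (0 : ℝ) 1 → ℝ := fun z => C * (-Real.log z) ^ (-α) with hX
  have hXm : Measurable X := by fun_prop
  have hXpos : ∀ᵐ z ∂(μ : Measure (Set.Icc (0 : ℝ) 1)), 0 < X z := by
    filter_upwards [ae_mem_Ioo_of_integral_rpow hα0 hC hμ] with z hz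
    have hl : 0 < -Real.log z := by
      have := Real.log_neg hz.1 hz.2
      linarith
    simp only [hX]
    positivity
  have hmom : ∀ n : ℕ, Integrable (fun z => X z ^ n) (μ : Measure (Set.Icc (0 : ℝ) 1)) ∧
      ∫ z, X z ^ n ∂(μ : Measure (Set.Icc (0 : ℝ) 1)) =
        n.factorial / Real.Gamma (α * n + 1) := fun n => by
    have h1 := lintegral_neg_log_rpow_pow hα0 hC hμ n
    have h2 : 0 ≤ᵐ[(μ : Measure (Set.Icc (0 : ℝ) 1))] fun z => X z ^ n := by
      filter_upwards [hXpos] with z hz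
      simp only [Pi.zero_apply]
      positivity
    have hG := Gamma_mul_nat_add_one_pos hα0.le n
    refine ⟨⟨(hXm.pow_const n).aestronglyMeasurable, ?_⟩, ?_⟩
    · rw [hasFiniteIntegral_iff_ofReal h2, h1]
      exact ENNReal.ofReal_lt_top
    · rw [integral_eq_lintegral_of_nonneg_ae h2 (hXm.pow_const n).aestronglyMeasurable, h1,
        ENNReal.toReal_ofReal (by positivity)]
  refine ⟨(μ : Measure (Set.Icc (0 : ℝ) 1)).map X,
    Measure.isProbabilityMeasure_map hXm.aemeasurable, ?_, fun x => ?_⟩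
  · rw [ae_map_iff hXm.aemeasurable measurableSet_Ioi]
    exact hXpos
  · rw [integral_map hXm.aemeasurable (by fun_prop)]
    have h1 : ∀ n : ℕ, ∫ z, (x * X z) ^ n / n.factorial ∂(μ : Measure (Set.Icc (0 : ℝ) 1)) =
        x ^ n / Real.Gamma (α * n + 1) := fun n => by
      simp_rw [mul_pow, mul_div_right_comm]
      rw [integral_const_mul, (hmom n).2]
      have : (n.factorial : ℝ) ≠ 0 := by positivity
      field_simp
    have h2 : ∀ n : ℕ, ∫ z, ‖(x * X z) ^ n / n.factorial‖ ∂(μ : Measure (Set.Icc (0 : ℝ) 1)) =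
        |x| ^ n / Real.Gamma (α * n + 1) := fun n => by
      have : ∫ z, ‖(x * X z) ^ n / n.factorial‖ ∂(μ : Measure (Set.Icc (0 : ℝ) 1)) =
          ∫ z, (|x| ^ n / n.factorial) * X z ^ n ∂(μ : Measure (Set.Icc (0 : ℝ) 1)) := by
        refine integral_congr_ae ?_
        filter_upwards [hXpos] with z hz
        rw [norm_div, norm_pow, norm_mul, Real.norm_of_nonneg hz.le, Real.norm_eq_abs,
          Real.norm_of_nonneg (by positivity), mul_pow, mul_div_right_comm]
      rw [this, integral_const_mul, (hmom n).2]
      have : (n.factorial : ℝ) ≠ 0 := by positivity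
      field_simp
    have h3 := hasSum_integral_of_summable_integral_norm
      (F := fun (n : ℕ) z => (x * X z) ^ n / n.factorial)
      (μ := (μ : Measure (Set.Icc (0 : ℝ) 1)))
      (fun n => by
        simp_rw [mul_pow, mul_div_right_comm]
        exact (hmom n).1.const_mul _)
      (by simpa only [h2] using summable_pow_div_Gamma hα0 |x|)
    have h4 : ∀ z, ∑' n : ℕ, (x * X z) ^ n / n.factorial = Real.exp (x * X z) := fun z => by
      rw [Real.exp_eq_exp_ℝ, NormedSpace.exp_eq_tsum_div]
    simp only [h1, h4] at h3
    exact (hasSum_mittagLeffler_ofReal hα0 x).unique (Complex.hasSum_ofReal.2 h3)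

/-! ### The Green function as a mixture of heat kernels -/

open FourierTransform in
/-- The multiplication formula for the Fourier transform of an integrable function whose Fourier
transform is even. -/
theorem integral_mul_schwartz_eq_of_fourier_even {V : Type*} [NormedAddCommGroup V]
    [InnerProductSpace ℝ V] [FiniteDimensional ℝ V] [MeasurableSpace V] [BorelSpace V]
    {g : V → ℂ} (hg : Integrable g) {m : V → ℂ} (hm : ∀ η, 𝓕 g η = m η)
    (heven : ∀ η, m (-η) = m η) (φ : SchwartzMap V ℂ) :
    ∫ x, g x * φ x = ∫ η, m η * 𝓕 (φ : V → ℂ) η := by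
  -- Duality is applied to `𝓕⁻ φ`, whose transform is φ; the remaining reflection ξ ↦ -ξ is absorbed
  -- by the evenness of m.
  have h1 := VectorFourier.integral_fourierIntegral_smul_eq_flip (μ := volume) (ν := volume)
    (L := innerₗ V) (f := g) (g := ((𝓕⁻ φ : SchwartzMap V ℂ) : V → ℂ))
    Real.continuous_fourierChar continuous_inner hg (𝓕⁻ φ : SchwartzMap V ℂ).integrable
  rw [flip_innerₗ] at h1
  have h2 : ∀ x, VectorFourier.fourierIntegral Real.fourierChar volume (innerₗ V)
      ((𝓕⁻ φ : SchwartzMap V ℂ) : V → ℂ) x = φ x := fun x => by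
    change 𝓕 ((𝓕⁻ φ : SchwartzMap V ℂ) : V → ℂ) x = φ x
    rw [← SchwartzMap.fourier_coe, FourierTransform.fourier_fourierInv_eq]
  have h3 : ∀ ξ, VectorFourier.fourierIntegral Real.fourierChar volume (innerₗ V) g ξ = m ξ := hm
  simp only [h2, h3, smul_eq_mul] at h1
  rw [← h1, ← integral_neg_eq_self]
  refine integral_congr_ae (ae_of_all _ fun ξ => ?_)
  simp only [heven, SchwartzMap.fourierInv_coe]
  rw [Real.fourierInv_eq_fourier_neg, neg_neg]

/-- The heat kernel at time `τ`. -/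
noncomputable def heatKernel {N : ℕ} (τ : ℝ) (x : EuclideanSpace ℝ (Fin N)) : ℝ :=
  (Real.pi / (4 * τ)⁻¹) ^ (-(N / 2 : ℝ)) * Real.exp (-(4 * τ)⁻¹ * ‖x‖ ^ 2)

theorem heatKernel_nonneg {N : ℕ} {τ : ℝ} (hτ : 0 < τ) (x : EuclideanSpace ℝ (Fin N)) :
    0 ≤ heatKernel τ x := by
  unfold heatKernel
  positivity

theorem integrable_heatKernel {N : ℕ} {τ : ℝ} (hτ : 0 < τ) :
    Integrable (heatKernel τ : EuclideanSpace ℝ (Fin N) → ℝ) := by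
  have hb : (0 : ℝ) < (((4 * τ)⁻¹ : ℝ) : ℂ).re := by
    rw [Complex.ofReal_re]
    positivity
  have h := (GaussianFourier.integrable_cexp_neg_mul_sq_norm_add
    (V := EuclideanSpace ℝ (Fin N)) hb 0 0).norm
  refine Integrable.const_mul (h.congr (ae_of_all _ fun v => ?_)) _
  simp only [zero_mul, add_zero, Complex.norm_exp]
  congr 1
  rw [← Complex.ofReal_neg, ← Complex.ofReal_pow, ← Complex.ofReal_mul, Complex.ofReal_re]

theorem integral_heatKernel {N : ℕ} {τ : ℝ} (hτ : 0 < τ) :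
    ∫ x : EuclideanSpace ℝ (Fin N), heatKernel τ x = 1 := by
  unfold heatKernel
  rw [integral_const_mul, GaussianFourier.integral_rexp_neg_mul_sq_norm (by positivity),
    finrank_euclideanSpace_fin, Real.rpow_neg (by positivity), inv_mul_cancel₀ (by positivity)]

open FourierTransform in
theorem fourier_heatKernel {N : ℕ} {τ : ℝ} (hτ : 0 < τ) (η : EuclideanSpace ℝ (Fin N)) :
    𝓕 (fun x : EuclideanSpace ℝ (Fin N) => (heatKernel τ x : ℂ)) η =
      (Real.exp (-‖(2 * Real.pi) • η‖ ^ 2 * τ) : ℂ) := by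
  have hb : (0 : ℝ) < (((4 * τ)⁻¹ : ℝ) : ℂ).re := by
    rw [Complex.ofReal_re]
    positivity
  have hP : (0 : ℝ) < Real.pi / (4 * τ)⁻¹ := by positivity
  have h := fourier_gaussian_innerProductSpace (V := EuclideanSpace ℝ (Fin N)) hb η
  have h2 : (fun x : EuclideanSpace ℝ (Fin N) => (heatKernel τ x : ℂ)) =
      (((Real.pi / (4 * τ)⁻¹) ^ (-(N / 2 : ℝ)) : ℝ) : ℂ) •
        fun v : EuclideanSpace ℝ (Fin N) => Complex.exp (-(((4 * τ)⁻¹ : ℝ) : ℂ) * ‖v‖ ^ 2) := by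
    ext x
    simp only [heatKernel, Pi.smul_apply, smul_eq_mul]
    push_cast
    ring_nf
  have h3 : (Real.pi / (((4 * τ)⁻¹ : ℝ) : ℂ)) ^ ((N : ℂ) / 2) =
      (((Real.pi / (4 * τ)⁻¹) ^ (N / 2 : ℝ) : ℝ) : ℂ) := by
    rw [Complex.ofReal_cpow hP.le]
    push_cast
    rfl
  have h5 : 𝓕 ((((Real.pi / (4 * τ)⁻¹) ^ (-(N / 2 : ℝ)) : ℝ) : ℂ) •
        fun v : EuclideanSpace ℝ (Fin N) => Complex.exp (-(((4 * τ)⁻¹ : ℝ) : ℂ) * ‖v‖ ^ 2)) η =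
      (((Real.pi / (4 * τ)⁻¹) ^ (-(N / 2 : ℝ)) : ℝ) : ℂ) *
      𝓕 (fun v : EuclideanSpace ℝ (Fin N) => Complex.exp (-(((4 * τ)⁻¹ : ℝ) : ℂ) * ‖v‖ ^ 2)) η := by
    rw [Real.fourier_eq, Real.fourier_eq, ← integral_const_mul]
    refine integral_congr_ae (ae_of_all _ fun v => ?_)
    simp only [Pi.smul_apply, smul_eq_mul, Circle.smul_def]
    ring
  rw [h2, h5, h, finrank_euclideanSpace_fin, h3, ← mul_assoc, ← Complex.ofReal_mul,
    ← Real.rpow_add hP, neg_add_cancel, Real.rpow_zero, Complex.ofReal_one, one_mul]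
  rw [norm_smul, Real.norm_of_nonneg (by positivity : 0 ≤ 2 * Real.pi)]
  push_cast
  congr 1
  have : (τ : ℂ) ≠ 0 := by exact_mod_cast hτ.ne'
  field_simp
  ring

/-- A mixture of heat kernels: subordination of the heat semigroup by the law `M`. -/
noncomputable def subordinatedKernel {N : ℕ} (M : Measure ℝ) (c : ℝ)
    (x : EuclideanSpace ℝ (Fin N)) : ℝ :=
  ∫ m, heatKernel (c * m) x ∂M

theorem subordinatedKernel_nonneg {N : ℕ} {M : Measure ℝ} {c : ℝ} (hM : ∀ᵐ m ∂M, 0 < m)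
    (hc : 0 < c) (x : EuclideanSpace ℝ (Fin N)) : 0 ≤ subordinatedKernel M c x :=
  integral_nonneg_of_ae (by
    filter_upwards [hM] with m hm using heatKernel_nonneg (mul_pos hc hm) x)

section subordinatedKernel

variable {N : ℕ} {M : Measure ℝ} [IsProbabilityMeasure M] {c : ℝ}

/-- Each heat kernel is nonnegative of mass 1 and M is a probability measure. This justifies the
Fubini interchanges for the mass and the Fourier transform of the mixture. -/
theorem integrable_prod_heatKernel (hM : ∀ᵐ m ∂M, 0 < m) (hc : 0 < c) :
    Integrable (fun q : EuclideanSpace ℝ (Fin N) × ℝ => heatKernel (c * q.2) q.1)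
      (volume.prod M) := by
  have hmeas : Measurable
      (fun q : EuclideanSpace ℝ (Fin N) × ℝ => heatKernel (c * q.2) q.1) := by
    unfold heatKernel
    fun_prop
  rw [integrable_prod_iff' hmeas.aestronglyMeasurable]
  constructor
  · filter_upwards [hM] with m hm using integrable_heatKernel (mul_pos hc hm)
  · refine (integrable_const (1 : ℝ)).congr ?_
    filter_upwards [hM] with m hm
    simp only [Real.norm_of_nonneg (heatKernel_nonneg (mul_pos hc hm) _)]
    rw [integral_heatKernel (mul_pos hc hm)]

theorem integrable_subordinatedKernel (hM : ∀ᵐ m ∂M, 0 < m) (hc : 0 < c) :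
    Integrable (subordinatedKernel M c : EuclideanSpace ℝ (Fin N) → ℝ) :=
  (integrable_prod_heatKernel hM hc).integral_prod_left

theorem integral_subordinatedKernel (hM : ∀ᵐ m ∂M, 0 < m) (hc : 0 < c) :
    ∫ x : EuclideanSpace ℝ (Fin N), subordinatedKernel M c x = 1 := by
  unfold subordinatedKernel
  rw [integral_integral_swap (integrable_prod_heatKernel hM hc)]
  have : ∫ m, (∫ x : EuclideanSpace ℝ (Fin N), heatKernel (c * m) x) ∂M = ∫ _, (1 : ℝ) ∂M := by
    refine integral_congr_ae ?_
    filter_upwards [hM] with m hm using integral_heatKernel (mul_pos hc hm)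
  rw [this]
  simp

theorem eLpNorm_subordinatedKernel (hM : ∀ᵐ m ∂M, 0 < m) (hc : 0 < c) :
    eLpNorm (subordinatedKernel M c : EuclideanSpace ℝ (Fin N) → ℝ) 1 volume = 1 := by
  rw [eLpNorm_one_eq_lintegral_enorm,
    ← ofReal_integral_norm_eq_lintegral_enorm (integrable_subordinatedKernel hM hc)]
  simp only [Real.norm_of_nonneg (subordinatedKernel_nonneg hM hc _)]
  rw [integral_subordinatedKernel hM hc, ENNReal.ofReal_one]

open FourierTransform in
theorem fourier_subordinatedKernel (hM : ∀ᵐ m ∂M, 0 < m) (hc : 0 < c)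
    (η : EuclideanSpace ℝ (Fin N)) :
    𝓕 (fun x : EuclideanSpace ℝ (Fin N) => (subordinatedKernel M c x : ℂ)) η =
      ((∫ m, Real.exp (-(‖(2 * Real.pi) • η‖ ^ 2 * c) * m) ∂M : ℝ) : ℂ) := by
  rw [Real.fourier_eq, ← integral_complex_ofReal]
  have h1 : ∀ v : EuclideanSpace ℝ (Fin N),
      Real.fourierChar (-inner ℝ v η) • (subordinatedKernel M c v : ℂ) =
      ∫ m, (Real.fourierChar (-inner ℝ v η) • (heatKernel (c * m) v : ℂ)) ∂M := fun v => by
    simp only [Circle.smul_def, smul_eq_mul]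
    rw [integral_const_mul, subordinatedKernel, integral_complex_ofReal]
  simp_rw [h1]
  rw [integral_integral_swap]
  · refine integral_congr_ae ?_
    filter_upwards [hM] with m hm
    rw [← Real.fourier_eq, fourier_heatKernel (mul_pos hc hm)]
    ring_nf
  · have h2 : Integrable (fun q : EuclideanSpace ℝ (Fin N) × ℝ =>
        ((heatKernel (c * q.2) q.1 : ℝ) : ℂ)) (volume.prod M) :=
      (integrable_prod_heatKernel hM hc).ofReal
    refine h2.mono ?_ (ae_of_all _ fun q => ?_)
    · have h3 : Continuous fun q : EuclideanSpace ℝ (Fin N) × ℝ =>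
          (Real.fourierChar (-inner ℝ q.1 η) : ℂ) :=
        continuous_subtype_val.comp (Real.continuous_fourierChar.comp (by fun_prop))
      exact h3.aestronglyMeasurable.mul h2.aestronglyMeasurable
    · simp only [Function.uncurry, Circle.norm_smul, le_refl]

end subordinatedKernel

open FourierTransform in
/-- The multiplication formula for the Green function. -/
theorem integral_subordinatedKernel_mul {N : ℕ} {α c : ℝ} {M : Measure ℝ}
    [IsProbabilityMeasure M] (hM : ∀ᵐ m ∂M, 0 < m) (hc : 0 < c)
    (hml : ∀ x : ℝ, mittagLeffler α x = ((∫ m, Real.exp (x * m) ∂M : ℝ) : ℂ))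
    (φ : SchwartzMap (EuclideanSpace ℝ (Fin N)) ℂ) :
    ∫ x, (subordinatedKernel M c x : ℂ) * φ x =
      ∫ η : EuclideanSpace ℝ (Fin N),
        mittagLeffler α ((-(‖(2 * Real.pi) • η‖ ^ 2 * c) : ℝ) : ℂ) *
          𝓕 (φ : EuclideanSpace ℝ (Fin N) → ℂ) η := by
  refine integral_mul_schwartz_eq_of_fourier_even
    (m := fun η => mittagLeffler α ((-(‖(2 * Real.pi) • η‖ ^ 2 * c) : ℝ) : ℂ))
    (integrable_subordinatedKernel hM hc).ofReal (fun η => ?_) (fun η => ?_) φ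
  · exact (fourier_subordinatedKernel hM hc η).trans (hml _).symm
  · rw [smul_neg, norm_neg]

theorem isGreenFunction_subordinatedKernel {N : ℕ} {α t : ℝ} {M : Measure ℝ}
    [IsProbabilityMeasure M] (hM : ∀ᵐ m ∂M, 0 < m) (ht : 0 < t)
    (hml : ∀ x : ℝ, mittagLeffler α x = ((∫ m, Real.exp (x * m) ∂M : ℝ) : ℂ)) :
    IsGreenFunction (N := N) α t (subordinatedKernel M (t ^ α)) := by
  have hc : 0 < t ^ α := by positivity
  refine ⟨integrable_subordinatedKernel hM hc, fun φ => ?_⟩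
  rw [integral_subordinatedKernel_mul hM hc hml φ]
  -- Substituting ξ = 2πη passes from the unitary normalisation of `𝓕` to that of G; the Jacobian is
  -- the factor (2π)^(-N).
  have h1 := Measure.integral_comp_smul (volume : Measure (EuclideanSpace ℝ (Fin N)))
    (fun ξ : EuclideanSpace ℝ (Fin N) => mittagLeffler α ((-(‖ξ‖ ^ 2 * t ^ α) : ℝ) : ℂ) *
      ∫ x : EuclideanSpace ℝ (Fin N),
        Complex.exp (-Complex.I * ((inner ℝ x ξ : ℝ) : ℂ)) * φ x) (2 * Real.pi)
  rw [finrank_euclideanSpace_fin, abs_of_pos (by positivity), Complex.real_smul] at h1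
  rw [one_div]
  push_cast at h1 ⊢
  rw [← h1]
  refine integral_congr_ae (ae_of_all _ fun η => ?_)
  simp only
  congr 1
  rw [Real.fourier_eq']
  refine integral_congr_ae (ae_of_all _ fun x => ?_)
  simp only [smul_eq_mul, inner_smul_right]
  congr 2
  push_cast
  ring

/-! ### Young's inequality -/

/-- Young's convolution inequality with one factor in `L¹`. -/
theorem eLpNorm_le_of_enorm_le_lintegral_mul_sub {V F₁ F₂ F₃ : Type*} [NormedAddCommGroup V]
    [MeasurableSpace V] [BorelSpace V] [SecondCountableTopology V]
    [NormedAddCommGroup F₁] [NormedAddCommGroup F₂] [NormedAddCommGroup F₃]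
    {μ : Measure V} [SFinite μ] [μ.IsAddLeftInvariant] [μ.IsNegInvariant]
    {k : V → F₁} {f : V → F₂} {g : V → F₃} (hk : AEStronglyMeasurable k μ)
    (hf : AEStronglyMeasurable f μ) {p : ℝ≥0∞} (hp : 1 ≤ p)
    (hg : ∀ x, ‖g x‖ₑ ≤ ∫⁻ y, ‖k y‖ₑ * ‖f (x - y)‖ₑ ∂μ) :
    eLpNorm g p μ ≤ eLpNorm k 1 μ * eLpNorm f p μ := by
  have hqmp : ∀ x : V, Measure.QuasiMeasurePreserving (fun y : V => x - y) μ μ := fun x =>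
    (Measure.measurePreserving_sub_left μ x).quasiMeasurePreserving
  rcases eq_or_ne p ∞ with rfl | hpt
  · rw [eLpNorm_exponent_top, eLpNorm_exponent_top]
    refine eLpNormEssSup_le_of_ae_enorm_bound (ae_of_all _ fun x => (hg x).trans ?_)
    rw [eLpNorm_one_eq_lintegral_enorm, ← lintegral_mul_const'' _ hk.enorm]
    refine lintegral_mono_ae ?_
    filter_upwards [(hqmp x).ae (enorm_ae_le_eLpNormEssSup f μ)] with y hy
    gcongr
  have hp0 : p ≠ 0 := (zero_lt_one.trans_le hp).ne'
  have hr1 : 1 ≤ p.toReal := by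
    rw [← ENNReal.toReal_one]
    exact ENNReal.toReal_mono hpt hp
  set r := p.toReal with hr
  have hr0 : 0 < r := by linarith
  -- For finite p, Hölder's comparison of L¹ and L^p with respect to the measure |k| dμ, of total
  -- mass ‖k‖₁, yields the pointwise bound that Tonelli then integrates.
  set ν := μ.withDensity fun y => ‖k y‖ₑ with hν
  have hνu : ν Set.univ = eLpNorm k 1 μ := by
    rw [hν, withDensity_apply _ MeasurableSet.univ, setLIntegral_univ,
      eLpNorm_one_eq_lintegral_enorm]
  have hpt' : ∀ x, ‖g x‖ₑ ^ r ≤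
      (∫⁻ y, ‖k y‖ₑ * ‖f (x - y)‖ₑ ^ r ∂μ) * (eLpNorm k 1 μ) ^ (r - 1) := fun x => by
    have hfx : AEStronglyMeasurable (fun y => f (x - y)) μ := hf.comp_quasiMeasurePreserving (hqmp x)
    have h1 := eLpNorm_le_eLpNorm_mul_rpow_measure_univ (μ := ν) (f := fun y => f (x - y)) hp
      (hfx.mono_ac (withDensity_absolutelyContinuous _ _))
    rw [eLpNorm_one_eq_lintegral_enorm, eLpNorm_eq_lintegral_rpow_enorm_toReal hp0 hpt, hνu, hν,
      lintegral_withDensity_eq_lintegral_mul₀ hk.enorm hfx.enorm,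
      lintegral_withDensity_eq_lintegral_mul₀ hk.enorm (hfx.enorm.pow_const _)] at h1
    calc ‖g x‖ₑ ^ r ≤ ((∫⁻ y, ‖k y‖ₑ * ‖f (x - y)‖ₑ ^ r ∂μ) ^ (1 / r) *
          eLpNorm k 1 μ ^ (1 / (1 : ℝ≥0∞).toReal - 1 / r)) ^ r := by
          gcongr
          exact (hg x).trans h1
      _ = _ := by
          rw [ENNReal.mul_rpow_of_nonneg _ _ hr0.le, ← ENNReal.rpow_mul, ← ENNReal.rpow_mul,
            one_div, inv_mul_cancel₀ hr0.ne', ENNReal.rpow_one, ENNReal.toReal_one]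
          congr 2
          field_simp
  rw [eLpNorm_eq_lintegral_rpow_enorm_toReal hp0 hpt,
    eLpNorm_eq_lintegral_rpow_enorm_toReal hp0 hpt, ← hr]
  have hprod : AEMeasurable (fun q : V × V => ‖k q.2‖ₑ * ‖f (q.1 - q.2)‖ₑ ^ r) (μ.prod μ) :=
    hk.enorm.comp_snd.mul
      ((hf.enorm.comp_quasiMeasurePreserving (quasiMeasurePreserving_sub μ μ)).pow_const _)
  have hI : ∫⁻ x, ‖g x‖ₑ ^ r ∂μ ≤ (eLpNorm k 1 μ) ^ r * ∫⁻ x, ‖f x‖ₑ ^ r ∂μ := by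
    calc ∫⁻ x, ‖g x‖ₑ ^ r ∂μ
        ≤ ∫⁻ x, (∫⁻ y, ‖k y‖ₑ * ‖f (x - y)‖ₑ ^ r ∂μ) * (eLpNorm k 1 μ) ^ (r - 1) ∂μ :=
          lintegral_mono hpt'
      _ = (∫⁻ x, (∫⁻ y, ‖k y‖ₑ * ‖f (x - y)‖ₑ ^ r ∂μ) ∂μ) * (eLpNorm k 1 μ) ^ (r - 1) :=
          lintegral_mul_const'' _ hprod.lintegral_prod_right'
      _ = (∫⁻ y, (∫⁻ x, ‖k y‖ₑ * ‖f (x - y)‖ₑ ^ r ∂μ) ∂μ) * (eLpNorm k 1 μ) ^ (r - 1) := by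
          rw [lintegral_lintegral_swap hprod]
      _ = (∫⁻ y, ‖k y‖ₑ * (∫⁻ x, ‖f x‖ₑ ^ r ∂μ) ∂μ) * (eLpNorm k 1 μ) ^ (r - 1) := by
          congr 1
          refine lintegral_congr fun y => ?_
          rw [lintegral_const_mul' _ _ enorm_ne_top,
            lintegral_sub_right_eq_self (fun x => ‖f x‖ₑ ^ r) y]
      _ = (eLpNorm k 1 μ * (eLpNorm k 1 μ) ^ (r - 1)) * ∫⁻ x, ‖f x‖ₑ ^ r ∂μ := by
          rw [lintegral_mul_const'' _ hk.enorm, eLpNorm_one_eq_lintegral_enorm]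
          ring
      _ = _ := by
          congr 1
          nth_rewrite 1 [← ENNReal.rpow_one (eLpNorm k 1 μ)]
          rw [← ENNReal.rpow_add_of_nonneg _ _ zero_le_one (by linarith)]
          congr 1
          ring
  calc (∫⁻ x, ‖g x‖ₑ ^ r ∂μ) ^ (1 / r)
      ≤ ((eLpNorm k 1 μ) ^ r * ∫⁻ x, ‖f x‖ₑ ^ r ∂μ) ^ (1 / r) := by gcongr
    _ = _ := by
        rw [ENNReal.mul_rpow_of_nonneg _ _ (by positivity), ← ENNReal.rpow_mul,
          mul_one_div_cancel hr0.ne', ENNReal.rpow_one]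

/-! ### Density of test functions in the Schwartz space -/

section SchwartzApproximation

variable {V : Type*} [NormedAddCommGroup V] [InnerProductSpace ℝ V] [FiniteDimensional ℝ V]

/-- A fixed smooth cutoff, equal to `1` on the ball of radius `R` about the origin. -/
noncomputable def ballCutoff (V : Type*) [NormedAddCommGroup V] [InnerProductSpace ℝ V]
    (R : ℝ) (hR : 0 < R) : ContDiffBump (0 : V) :=
  ⟨R, R + 1, hR, by linarith⟩

theorem exists_norm_iteratedFDeriv_one_sub_le (i : ℕ) : ∃ B : ℝ, 0 ≤ B ∧ ∀ x : V,
    ‖iteratedFDeriv ℝ i (fun y => 1 - ballCutoff V 1 one_pos y) x‖ ≤ B := by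
  have hs : ContDiff ℝ ∞ (ballCutoff V 1 one_pos : V → ℝ) := (ballCutoff V 1 one_pos).contDiff
  let S : SchwartzMap V ℝ := (ballCutoff V 1 one_pos).hasCompactSupport.toSchwartzMap hs
  refine ⟨1 + SchwartzMap.seminorm ℝ 0 i S, by positivity, fun x => ?_⟩
  have h1 : iteratedFDeriv ℝ i (fun y => 1 - ballCutoff V 1 one_pos y) x =
      iteratedFDeriv ℝ i (fun _ : V => (1 : ℝ)) x -
        iteratedFDeriv ℝ i (ballCutoff V 1 one_pos : V → ℝ) x := by
    have := iteratedFDeriv_sub_apply (𝕜 := ℝ) (i := i) (x := x) (f := fun _ : V => (1 : ℝ))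
      (g := (ballCutoff V 1 one_pos : V → ℝ)) contDiffAt_const
      ((hs.of_le (by exact_mod_cast le_top)).contDiffAt)
    exact this
  rw [h1]
  refine (norm_sub_le _ _).trans (add_le_add ?_ ?_)
  · rcases Nat.eq_zero_or_pos i with rfl | hi
    · simp
    · rw [iteratedFDeriv_const_of_ne hi.ne']
      simp
  · have := SchwartzMap.le_seminorm ℝ 0 i S x
    rw [pow_zero, one_mul] at this
    exact this

/-- The error vanishes for ‖x‖ < n+1, so one extra power of ‖x‖ buys the factor 1/(n+1). Derivatives
of the dilated cutoff stay bounded because the dilation factor is at most 1. -/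
theorem exists_seminorm_cutoff_sub_le (ψ : SchwartzMap V ℂ) (k m : ℕ) : ∃ C : ℝ, 0 ≤ C ∧
    ∀ (n : ℕ) (x : V), ‖x‖ ^ k * ‖iteratedFDeriv ℝ m
      (fun x => (1 - ballCutoff V 1 one_pos (((n : ℝ) + 1)⁻¹ • x)) • ψ x) x‖ ≤
        C / ((n : ℝ) + 1) := by
  choose B hB0 hB using fun i => exists_norm_iteratedFDeriv_one_sub_le (V := V) i
  refine ⟨∑ i ∈ Finset.range (m + 1), (m.choose i : ℝ) * B i *
    SchwartzMap.seminorm ℝ (k + 1) (m - i) ψ, ?_, fun n x => ?_⟩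
  · exact Finset.sum_nonneg fun i _ => by
      have := hB0 i
      positivity
  have hn : (0 : ℝ) < (n : ℝ) + 1 := by positivity
  have hs : ContDiff ℝ ∞ (fun y : V => 1 - ballCutoff V 1 one_pos y) :=
    contDiff_const.sub (ballCutoff V 1 one_pos).contDiff
  set g : V → ℝ := fun x => 1 - ballCutoff V 1 one_pos (((n : ℝ) + 1)⁻¹ • x) with hg
  have hgs : ContDiff ℝ ∞ g := hs.comp (contDiff_const_smul _)
  rcases lt_or_ge ‖x‖ ((n : ℝ) + 1) with hx | hx
  · have h0 : (fun x => g x • ψ x) =ᶠ[𝓝 x] fun _ => 0 := by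
      filter_upwards [(isOpen_lt continuous_norm continuous_const).mem_nhds hx] with y hy
      have : ballCutoff V 1 one_pos (((n : ℝ) + 1)⁻¹ • y) = 1 := by
        refine (ballCutoff V 1 one_pos).one_of_mem_closedBall ?_
        rw [mem_closedBall_zero_iff, norm_smul, norm_inv, Real.norm_of_nonneg hn.le]
        change _ ≤ (1 : ℝ)
        rw [inv_mul_le_one₀ hn]
        exact le_of_lt hy
      simp [hg, this]
    rw [(h0.iteratedFDeriv ℝ m).eq_of_nhds]
    have : iteratedFDeriv ℝ m (fun _ : V => (0 : ℂ)) x = 0 := by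
      simp
    rw [this, norm_zero, mul_zero]
    refine div_nonneg (Finset.sum_nonneg fun i _ => ?_) hn.le
    have := hB0 i
    positivity
  · have h1 := norm_iteratedFDeriv_smul_le (n := m) hgs (ψ.smooth ⊤) x (by exact_mod_cast le_top)
    have h2 : ∀ i, ‖iteratedFDeriv ℝ i g x‖ ≤ B i := fun i => by
      rw [hg, iteratedFDeriv_comp_const_smul (𝕜 := ℝ)
        (f := fun y : V => 1 - ballCutoff V 1 one_pos y) (i := i) _
        (hs.of_le (by exact_mod_cast le_top)), norm_smul, norm_pow, norm_inv,
        Real.norm_of_nonneg hn.le]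
      refine (mul_le_of_le_one_left (norm_nonneg _) ?_).trans (hB i _)
      exact pow_le_one₀ (by positivity) (inv_le_one_of_one_le₀ (by
        have : (0 : ℝ) ≤ n := by positivity
        linarith))
    have h3 : ∀ j, ‖x‖ ^ k * ‖iteratedFDeriv ℝ j ψ x‖ ≤
        SchwartzMap.seminorm ℝ (k + 1) j ψ / ((n : ℝ) + 1) := fun j => by
      rw [le_div_iff₀ hn]
      calc ‖x‖ ^ k * ‖iteratedFDeriv ℝ j ψ x‖ * ((n : ℝ) + 1)
          ≤ ‖x‖ ^ k * ‖iteratedFDeriv ℝ j ψ x‖ * ‖x‖ := by gcongr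
        _ = ‖x‖ ^ (k + 1) * ‖iteratedFDeriv ℝ j ψ x‖ := by ring
        _ ≤ _ := SchwartzMap.le_seminorm ℝ (k + 1) j ψ x
    calc ‖x‖ ^ k * ‖iteratedFDeriv ℝ m (fun x => g x • ψ x) x‖
        ≤ ‖x‖ ^ k * ∑ i ∈ Finset.range (m + 1), (m.choose i : ℝ) * ‖iteratedFDeriv ℝ i g x‖ *
            ‖iteratedFDeriv ℝ (m - i) ψ x‖ := by
          gcongr
      _ = ∑ i ∈ Finset.range (m + 1), (m.choose i : ℝ) * ‖iteratedFDeriv ℝ i g x‖ *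
            (‖x‖ ^ k * ‖iteratedFDeriv ℝ (m - i) ψ x‖) := by
          rw [Finset.mul_sum]
          exact Finset.sum_congr rfl fun i _ => by ring
      _ ≤ ∑ i ∈ Finset.range (m + 1), (m.choose i : ℝ) * B i *
            (SchwartzMap.seminorm ℝ (k + 1) (m - i) ψ / ((n : ℝ) + 1)) := by
          refine Finset.sum_le_sum fun i _ => ?_
          have := hB0 i
          gcongr
          · exact h2 i
          · exact h3 (m - i)
      _ = _ := by
          rw [Finset.sum_div]
          exact Finset.sum_congr rfl fun i _ => by ring

/-- Smooth compactly supported functions are sequentially dense in the Schwartz space. -/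
theorem SchwartzMap.exists_seq_hasCompactSupport_tendsto (ψ : SchwartzMap V ℂ) :
    ∃ u : ℕ → SchwartzMap V ℂ, (∀ n, HasCompactSupport (u n)) ∧ Tendsto u atTop (𝓝 ψ) := by
  have hs : ∀ n : ℕ, ContDiff ℝ ∞
      (fun x : V => (ballCutoff V 1 one_pos (((n : ℝ) + 1)⁻¹ • x)) • ψ x) := fun n =>
    ((ballCutoff V 1 one_pos).contDiff.comp (contDiff_const_smul _)).smul (ψ.smooth ⊤)
  have hc : ∀ n : ℕ, HasCompactSupport
      (fun x : V => (ballCutoff V 1 one_pos (((n : ℝ) + 1)⁻¹ • x)) • ψ x) := fun n => by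
    have h : ((n : ℝ) + 1)⁻¹ ≠ 0 := by positivity
    exact ((ballCutoff V 1 one_pos).hasCompactSupport.comp_smul h).smul_right
  refine ⟨fun n => (hc n).toSchwartzMap (hs n), fun n => hc n, ?_⟩
  rw [(schwartz_withSeminorms ℝ V ℂ).tendsto_nhds]
  rintro ⟨k, m⟩ ε hε
  obtain ⟨C, hC0, hC⟩ := exists_seminorm_cutoff_sub_le ψ k m
  have hlim : Tendsto (fun n : ℕ => C / ((n : ℝ) + 1)) atTop (𝓝 0) :=
    tendsto_const_div_atTop_nhds_zero_nat C |>.comp (tendsto_add_atTop_nat 1) |>.congr fun n => by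
      simp
  filter_upwards [hlim.eventually_lt_const hε] with n hn
  refine lt_of_le_of_lt ?_ hn
  rw [SchwartzMap.schwartzSeminormFamily_apply, ← map_neg_eq_map, neg_sub]
  refine SchwartzMap.seminorm_le_bound ℝ k m _ (by positivity) fun x => ?_
  refine le_trans (le_of_eq ?_) (hC n x)
  congr 3
  ext y
  simp [sub_smul]

end SchwartzApproximation

/-! ### Iterated Laplacians of bandlimited functions -/

section Bandlimited

open FourierTransform

variable {V : Type*} [NormedAddCommGroup V] [InnerProductSpace ℝ V] [FiniteDimensional ℝ V]

/-- The iterated Laplacian on the Schwartz space. -/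
noncomputable def iteratedLaplacian (n : ℕ) (f : SchwartzMap V ℂ) : SchwartzMap V ℂ :=
  (fun g : SchwartzMap V ℂ => Δ g)^[n] f

@[simp]
theorem iteratedLaplacian_zero (f : SchwartzMap V ℂ) : iteratedLaplacian 0 f = f := rfl

theorem iteratedLaplacian_succ (n : ℕ) (f : SchwartzMap V ℂ) :
    iteratedLaplacian (n + 1) f = Δ (iteratedLaplacian n f) :=
  Function.iterate_succ_apply' _ _ _

variable [MeasurableSpace V] [BorelSpace V]

theorem fourier_laplacian_apply (f : SchwartzMap V ℂ) (ξ : V) :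
    𝓕 (Δ f) ξ = -((‖(2 * Real.pi) • ξ‖ ^ 2 : ℝ) : ℂ) * 𝓕 f ξ := by
  rw [SchwartzMap.laplacian_eq_fourierMultiplierCLM, SchwartzMap.fourierMultiplierCLM_apply,
    FourierTransform.fourier_smul, FourierTransform.fourier_fourierInv_eq, smul_apply,
    SchwartzMap.smulLeftCLM_apply_apply (by fun_prop), norm_smul,
    Real.norm_of_nonneg (by positivity : 0 ≤ 2 * Real.pi)]
  simp only [Complex.real_smul]
  push_cast
  ring

theorem fourier_iteratedLaplacian_apply (n : ℕ) (f : SchwartzMap V ℂ) (ξ : V) :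
    𝓕 (iteratedLaplacian n f) ξ = (-((‖(2 * Real.pi) • ξ‖ ^ 2 : ℝ) : ℂ)) ^ n * 𝓕 f ξ := by
  induction n with
  | zero => simp
  | succ n ih => rw [iteratedLaplacian_succ, fourier_laplacian_apply, ih, pow_succ]; ring

/-- On the support of 𝓕ψ the symbol of Δ agrees with a smooth compactly supported one, the transform
of a Schwartz k. The same k serves every n because Δ does not enlarge the spectrum. -/
theorem exists_laplacian_eq_convolution {ψ : SchwartzMap V ℂ}
    (hψ : HasCompactSupport (𝓕 ψ : SchwartzMap V ℂ)) :
    ∃ k : SchwartzMap V ℂ, ∀ n : ℕ, iteratedLaplacian (n + 1) ψ =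
      SchwartzMap.convolution (ContinuousLinearMap.mul ℂ ℂ) k (iteratedLaplacian n ψ) := by
  obtain ⟨R, hR0, hR⟩ : ∃ R : ℝ, 0 < R ∧ tsupport (𝓕 ψ : SchwartzMap V ℂ) ⊆
      Metric.closedBall 0 R := by
    obtain ⟨R, hR⟩ := hψ.isCompact.isBounded.subset_closedBall (0 : V)
    exact ⟨max R 1, by positivity, hR.trans (Metric.closedBall_subset_closedBall (le_max_left _ _))⟩
  have hs : ContDiff ℝ ∞ (fun ξ : V => ballCutoff V R hR0 ξ •
      (-((‖(2 * Real.pi) • ξ‖ ^ 2 : ℝ) : ℂ))) := by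
    refine (ballCutoff V R hR0).contDiff.smul (ContDiff.neg ?_)
    exact Complex.ofRealCLM.contDiff.comp ((contDiff_const_smul _).norm_sq ℝ)
  have hc : HasCompactSupport (fun ξ : V => ballCutoff V R hR0 ξ •
      (-((‖(2 * Real.pi) • ξ‖ ^ 2 : ℝ) : ℂ))) :=
    (ballCutoff V R hR0).hasCompactSupport.smul_right
  refine ⟨𝓕⁻ (hc.toSchwartzMap hs), fun n => ?_⟩
  apply (FourierTransform.fourierEquiv ℂ (SchwartzMap V ℂ)).injective
  simp only [FourierTransform.fourierEquiv_apply]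
  rw [SchwartzMap.fourier_convolution, FourierTransform.fourier_fourierInv_eq]
  ext ξ
  rw [SchwartzMap.pairing_apply_apply, iteratedLaplacian_succ, fourier_laplacian_apply,
    fourier_iteratedLaplacian_apply, ContinuousLinearMap.mul_apply',
    HasCompactSupport.toSchwartzMap_toFun]
  by_cases hξ : (𝓕 ψ : SchwartzMap V ℂ) ξ = 0
  · simp [hξ]
  · have h1 : ballCutoff V R hR0 ξ = 1 :=
      (ballCutoff V R hR0).one_of_mem_closedBall (hR (subset_tsupport _ hξ))
    rw [h1, one_smul]

/-- A Bernstein inequality with rate ‖k‖₁; convolution covers q = 1 and q = ∞ as well. -/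
theorem exists_eLpNorm_iteratedLaplacian_le {ψ : SchwartzMap V ℂ}
    (hψ : HasCompactSupport (𝓕 ψ : SchwartzMap V ℂ)) {q : ℝ≥0∞} (hq : 1 ≤ q) :
    ∃ R : ℝ≥0, ∀ n : ℕ, eLpNorm (iteratedLaplacian n ψ) q volume ≤
      R ^ n * eLpNorm ψ q volume := by
  obtain ⟨k, hk⟩ := exists_laplacian_eq_convolution hψ
  have hkfin : eLpNorm k 1 volume ≠ ⊤ := (k.eLpNorm_lt_top 1 volume).ne
  refine ⟨(eLpNorm k 1 volume).toNNReal, fun n => ?_⟩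
  rw [ENNReal.coe_toNNReal hkfin]
  induction n with
  | zero => simp
  | succ n ih =>
    calc eLpNorm (iteratedLaplacian (n + 1) ψ) q volume
        ≤ eLpNorm k 1 volume * eLpNorm (iteratedLaplacian n ψ) q volume := by
          refine eLpNorm_le_of_enorm_le_lintegral_mul_sub k.continuous.aestronglyMeasurable
            (iteratedLaplacian n ψ).continuous.aestronglyMeasurable hq fun x => ?_
          rw [hk n, SchwartzMap.convolution_apply]
          refine (enorm_integral_le_lintegral_enorm _).trans (le_of_eq ?_)
          simp [enorm_mul]
      _ ≤ eLpNorm k 1 volume * (eLpNorm k 1 volume ^ n * eLpNorm ψ q volume) := by gcongr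
      _ = _ := by rw [pow_succ]; ring

end Bandlimited

open FourierTransform in
/-- The action of the Green function on a bandlimited function is given by the power series of the
Mittag-Leffler function in the Laplacian. -/
theorem hasSum_iteratedLaplacian_div_Gamma {N : ℕ} {α c : ℝ} {M : Measure ℝ}
    [IsProbabilityMeasure M] (hM : ∀ᵐ m ∂M, 0 < m) (hα : 0 < α) (hc : 0 < c)
    (hml : ∀ x : ℝ, mittagLeffler α x = ((∫ m, Real.exp (x * m) ∂M : ℝ) : ℂ))
    {ψ : SchwartzMap (EuclideanSpace ℝ (Fin N)) ℂ}
    (hψ : HasCompactSupport (𝓕 ψ : SchwartzMap (EuclideanSpace ℝ (Fin N)) ℂ))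
    (x : EuclideanSpace ℝ (Fin N)) :
    HasSum (fun n : ℕ => ((c ^ n / Real.Gamma (α * n + 1) : ℝ) : ℂ) * iteratedLaplacian n ψ x)
      (∫ y, (subordinatedKernel M c y : ℂ) * ψ (x + y)) := by
  obtain ⟨R, hR0, hR⟩ : ∃ R : ℝ, 0 ≤ R ∧ ∀ ξ : EuclideanSpace ℝ (Fin N),
      (𝓕 ψ : SchwartzMap (EuclideanSpace ℝ (Fin N)) ℂ) ξ ≠ 0 →
        ‖(2 * Real.pi) • ξ‖ ^ 2 ≤ R := by
    obtain ⟨R, hR⟩ := (hψ.isCompact.image (f := fun ξ : EuclideanSpace ℝ (Fin N) =>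
      ‖(2 * Real.pi) • ξ‖ ^ 2) (by fun_prop)).bddAbove
    exact ⟨max R 0, le_max_right _ _, fun ξ hξ =>
      (hR ⟨ξ, subset_tsupport _ hξ, rfl⟩).trans (le_max_left _ _)⟩
  set Fψ : SchwartzMap (EuclideanSpace ℝ (Fin N)) ℂ := 𝓕 ψ with hFψ
  let F : ℕ → EuclideanSpace ℝ (Fin N) → ℂ := fun n ξ =>
    ((c ^ n / Real.Gamma (α * n + 1) : ℝ) : ℂ) *
      (Real.fourierChar (inner ℝ ξ x) • (𝓕 (iteratedLaplacian n ψ) :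
        SchwartzMap (EuclideanSpace ℝ (Fin N)) ℂ) ξ)
  have hFint : ∀ n, Integrable (F n) := fun n => by
    refine Integrable.const_mul ?_ _
    have h := (𝓕 (iteratedLaplacian n ψ) :
      SchwartzMap (EuclideanSpace ℝ (Fin N)) ℂ).integrable (μ := volume)
    have h3 : Continuous fun ξ : EuclideanSpace ℝ (Fin N) =>
        (Real.fourierChar (inner ℝ ξ x) : ℂ) :=
      continuous_subtype_val.comp (Real.continuous_fourierChar.comp (by fun_prop))
    refine h.mono (h3.aestronglyMeasurable.mul h.aestronglyMeasurable) (ae_of_all _ fun ξ => ?_)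
    rw [Circle.norm_smul]
  have hFn : ∀ n, ∫ ξ, F n ξ =
      ((c ^ n / Real.Gamma (α * n + 1) : ℝ) : ℂ) * iteratedLaplacian n ψ x := fun n => by
    simp only [F]
    rw [integral_const_mul, ← Real.fourierInv_eq, ← SchwartzMap.fourierInv_coe,
      FourierTransform.fourierInv_fourier_eq]
  have hnorm : ∀ n ξ, ‖F n ξ‖ ≤ (R * c) ^ n / Real.Gamma (α * n + 1) * ‖Fψ ξ‖ := fun n ξ => by
    have hG := Gamma_mul_nat_add_one_pos hα.le n
    simp only [F]
    rw [norm_mul, Circle.norm_smul, fourier_iteratedLaplacian_apply, Complex.norm_real,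
      Real.norm_of_nonneg (by positivity), norm_mul, norm_pow, norm_neg, Complex.norm_real,
      Real.norm_of_nonneg (by positivity), ← hFψ]
    by_cases hξ : Fψ ξ = 0
    · simp [hξ]
    · have := hR ξ hξ
      rw [mul_pow, mul_comm (R ^ n), mul_div_right_comm, mul_assoc (_ / _)]
      gcongr
  have hsum : Summable fun n => ∫ ξ, ‖F n ξ‖ := by
    refine Summable.of_nonneg_of_le (fun n => integral_nonneg fun _ => norm_nonneg _)
      (fun n => (integral_mono (hFint n).norm (Fψ.integrable.norm.const_mul _) (hnorm n)).trans
        (integral_const_mul _ _).le) ((summable_pow_div_Gamma hα (R * c)).mul_right _)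
  have h1 := hasSum_integral_of_summable_integral_norm hFint hsum
  simp only [hFn] at h1
  convert! h1 using 1
  -- Translating the test function by x becomes multiplication by a character on the Fourier side,
  -- which turns the integral into an inverse transform evaluated at x.
  have h2 := integral_subordinatedKernel_mul hM hc hml (ψ.compSubConstCLM ℂ (-x))
  simp only [SchwartzMap.compSubConstCLM_apply, sub_neg_eq_add, add_comm _ x] at h2
  rw [h2]
  refine integral_congr_ae (ae_of_all _ fun ξ => ?_)
  have h3 : 𝓕 ((ψ.compSubConstCLM ℂ (-x) : SchwartzMap (EuclideanSpace ℝ (Fin N)) ℂ) :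
      EuclideanSpace ℝ (Fin N) → ℂ) ξ = Real.fourierChar (inner ℝ ξ x) • Fψ ξ := by
    have h4 := congrFun (VectorFourier.fourierIntegral_comp_add_right Real.fourierChar volume
      (innerₗ (EuclideanSpace ℝ (Fin N))) (ψ : EuclideanSpace ℝ (Fin N) → ℂ) x) ξ
    rw [real_inner_comm]
    have h6 : ((ψ.compSubConstCLM ℂ (-x) : SchwartzMap (EuclideanSpace ℝ (Fin N)) ℂ) :
        EuclideanSpace ℝ (Fin N) → ℂ) = ψ ∘ fun v => v + x := by
      ext y
      simp
    rw [h6]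
    exact h4
  simp only
  rw [h3]
  have h5 := (hasSum_mittagLeffler_ofReal hα (-(‖(2 * Real.pi) • ξ‖ ^ 2 * c))).mul_right
    (Real.fourierChar (inner ℝ ξ x) • Fψ ξ)
  rw [← h5.tsum_eq]
  refine tsum_congr fun n => ?_
  simp only [F, fourier_iteratedLaplacian_apply, ← hFψ, Circle.smul_def, smul_eq_mul]
  rw [← neg_mul, mul_pow]
  push_cast
  ring

/-! ### Fractional integrals and Picard iteration -/

section RiemannLiouville

variable {α t : ℝ} {f g : ℝ → ℝ}

theorem intervalIntegrable_sub_rpow (hα : 0 < α) (t : ℝ) :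
    IntervalIntegrable (fun s : ℝ => (t - s) ^ (α - 1)) volume 0 t := by
  have h := (intervalIntegral.intervalIntegrable_rpow' (a := 0) (b := t)
    (by linarith : -1 < α - 1)).comp_sub_left t
  simpa using h.symm

/-- `f` is measurable and bounded on `(0, t]`. -/
def BoundedMeasurableOn (f : ℝ → ℝ) (t : ℝ) : Prop :=
  AEStronglyMeasurable f (volume.restrict (Set.Ioc 0 t)) ∧ ∃ C : ℝ, ∀ s ∈ Set.Ioc 0 t, |f s| ≤ C

theorem BoundedMeasurableOn.mono (hf : BoundedMeasurableOn f t) {s : ℝ} (hs : s ≤ t) :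
    BoundedMeasurableOn f s :=
  ⟨hf.1.mono_measure (Measure.restrict_mono (Set.Ioc_subset_Ioc_right hs) le_rfl),
    hf.2.imp fun _ h r hr => h r ⟨hr.1, hr.2.trans hs⟩⟩

theorem BoundedMeasurableOn.sub (hf : BoundedMeasurableOn f t) (hg : BoundedMeasurableOn g t) :
    BoundedMeasurableOn (fun s => f s - g s) t := by
  obtain ⟨hf, A, hA⟩ := hf
  obtain ⟨hg, B, hB⟩ := hg
  exact ⟨hf.sub hg, A + B, fun s hs => (abs_sub _ _).trans (add_le_add (hA s hs) (hB s hs))⟩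

theorem boundedMeasurableOn_sum {ι : Type*} (S : Finset ι) {F : ι → ℝ → ℝ}
    (hF : ∀ i ∈ S, BoundedMeasurableOn (F i) t) :
    BoundedMeasurableOn (fun s => ∑ i ∈ S, F i s) t := by
  choose! h1 B hB using hF
  refine ⟨Finset.aestronglyMeasurable_fun_sum S h1, ∑ i ∈ S, B i, fun s hs => ?_⟩
  exact (Finset.abs_sum_le_sum_abs _ _).trans (Finset.sum_le_sum fun i hi => hB i hi s hs)

theorem boundedMeasurableOn_const_mul_rpow {β : ℝ} (hβ : 0 ≤ β) (c : ℝ) :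
    BoundedMeasurableOn (fun s => c * s ^ β) t := by
  refine ⟨by fun_prop, |c| * t ^ β, fun s hs => ?_⟩
  rw [abs_mul, abs_of_nonneg (Real.rpow_nonneg hs.1.le _)]
  exact mul_le_mul_of_nonneg_left (Real.rpow_le_rpow hs.1.le hs.2 hβ) (abs_nonneg _)

theorem BoundedMeasurableOn.intervalIntegrable (hα : 0 < α) (ht : 0 < t)
    (hf : BoundedMeasurableOn f t) :
    IntervalIntegrable (fun s => (t - s) ^ (α - 1) * f s) volume 0 t := by
  obtain ⟨hf, C, hC⟩ := hf
  have h := intervalIntegrable_sub_rpow hα t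
  rw [intervalIntegrable_iff_integrableOn_Ioc_of_le ht.le] at h ⊢
  refine Integrable.mul_bdd (c := C) h hf ?_
  filter_upwards [ae_restrict_mem measurableSet_Ioc] with s hs using hC s hs

theorem rlIntegral_sub (hα : 0 < α) (ht : 0 < t) (hf : BoundedMeasurableOn f t)
    (hg : BoundedMeasurableOn g t) :
    rlIntegral α (fun s => f s - g s) t = rlIntegral α f t - rlIntegral α g t := by
  unfold rlIntegral
  simp_rw [mul_sub]
  rw [intervalIntegral.integral_sub (hf.intervalIntegrable hα ht) (hg.intervalIntegrable hα ht),
    mul_sub]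

theorem rlIntegral_sum (hα : 0 < α) (ht : 0 < t) {ι : Type*} (S : Finset ι) {F : ι → ℝ → ℝ}
    (hF : ∀ i ∈ S, BoundedMeasurableOn (F i) t) :
    rlIntegral α (fun s => ∑ i ∈ S, F i s) t = ∑ i ∈ S, rlIntegral α (F i) t := by
  unfold rlIntegral
  simp_rw [Finset.mul_sum]
  rw [intervalIntegral.integral_finsetSum fun i hi => (hF i hi).intervalIntegrable hα ht,
    Finset.mul_sum]

theorem rlIntegral_const_mul (c : ℝ) :
    rlIntegral α (fun s => c * f s) t = c * rlIntegral α f t := by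
  unfold rlIntegral
  simp_rw [mul_left_comm _ c]
  rw [intervalIntegral.integral_const_mul, mul_left_comm]

/-- A rescaled Beta integral. These Gamma quotients telescope under iteration to 1/Γ(αn+1). -/
theorem rlIntegral_rpow (hα : 0 < α) (ht : 0 < t) {β : ℝ} (hβ : 0 ≤ β) :
    rlIntegral α (fun s => s ^ β) t =
      Real.Gamma (β + 1) / Real.Gamma (β + α + 1) * t ^ (β + α) := by
  have h1 := Complex.betaIntegral_scaled ((β + 1 : ℝ) : ℂ) (α : ℂ) ht
  have hβ' : 0 < (((β + 1 : ℝ) : ℂ)).re := by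
    rw [Complex.ofReal_re]
    linarith
  rw [Complex.betaIntegral_eq_Gamma_mul_div _ _ hβ' (by simpa using hα)] at h1
  have h2 : ∫ x in (0 : ℝ)..t, (x : ℂ) ^ (((β + 1 : ℝ) : ℂ) - 1) * ((t : ℂ) - x) ^ ((α : ℂ) - 1) =
      ((∫ s in (0 : ℝ)..t, (t - s) ^ (α - 1) * s ^ β : ℝ) : ℂ) := by
    rw [← intervalIntegral.integral_ofReal]
    refine intervalIntegral.integral_congr fun s hs => ?_
    rw [Set.uIcc_of_le ht.le] at hs
    rw [Complex.ofReal_mul, Complex.ofReal_cpow (by linarith [hs.2]), Complex.ofReal_cpow hs.1]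
    push_cast
    rw [add_sub_cancel_right, mul_comm]
  have h3 : (t : ℂ) ^ (((β + 1 : ℝ) : ℂ) + α - 1) = ((t ^ (β + α) : ℝ) : ℂ) := by
    rw [Complex.ofReal_cpow ht.le]
    congr 1
    push_cast
    ring
  rw [h2, h3, ← Complex.ofReal_add, Complex.Gamma_ofReal, Complex.Gamma_ofReal,
    Complex.Gamma_ofReal, ← Complex.ofReal_mul, ← Complex.ofReal_div, ← Complex.ofReal_mul,
    Complex.ofReal_inj] at h1
  have hG : 0 < Real.Gamma α := Real.Gamma_pos_of_pos hα
  unfold rlIntegral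
  rw [h1, show β + 1 + α = β + α + 1 by ring]
  field_simp

theorem abs_rlIntegral_le (hα : 0 < α) (ht : 0 < t) {β C : ℝ} (hβ : 0 ≤ β)
    (hf : ∀ s ∈ Set.Ioc 0 t, |f s| ≤ C * s ^ β) :
    |rlIntegral α f t| ≤ C * (Real.Gamma (β + 1) / Real.Gamma (β + α + 1) * t ^ (β + α)) := by
  have hG : 0 < Real.Gamma α := Real.Gamma_pos_of_pos hα
  rw [← rlIntegral_rpow hα ht hβ, ← rlIntegral_const_mul]
  unfold rlIntegral
  rw [abs_mul, abs_of_pos (by positivity : 0 < 1 / Real.Gamma α)]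
  gcongr
  rw [← Real.norm_eq_abs]
  refine intervalIntegral.norm_integral_le_of_norm_le ht.le (ae_of_all _ fun s hs => ?_)
    ((boundedMeasurableOn_const_mul_rpow hβ C).intervalIntegrable hα ht)
  have h0 : 0 ≤ (t - s) ^ (α - 1) := Real.rpow_nonneg (by linarith [hs.2]) _
  rw [norm_mul, Real.norm_of_nonneg h0]
  gcongr
  exact hf s hs

/-- Picard iteration for a hierarchy of Abel-Volterra equations `W j = a j + I^α W (j + 1)` whose
levels grow at most geometrically. -/
theorem abs_sub_sum_le_of_hierarchy (hα : 0 < α) {T C R : ℝ} {W : ℕ → ℝ → ℝ}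
    {a : ℕ → ℝ} (hmeas : ∀ j, AEStronglyMeasurable (W j) (volume.restrict (Set.Ioc 0 T)))
    (hbound : ∀ j, ∀ s ∈ Set.Ioc 0 T, |W j s| ≤ C * R ^ j)
    (heq : ∀ j, ∀ s ∈ Set.Ioc 0 T, W j s = a j + rlIntegral α (W (j + 1)) s) (n : ℕ) :
    ∀ j, ∀ s ∈ Set.Ioc 0 T,
      |W j s - ∑ k ∈ Finset.range n, a (j + k) / Real.Gamma (α * k + 1) * s ^ (α * k)| ≤
        C * R ^ (j + n) / Real.Gamma (α * n + 1) * s ^ (α * n) := by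
  induction n with
  | zero => simpa using hbound
  | succ n ih =>
    intro j s hs
    have hαn : ∀ k : ℕ, 0 ≤ α * k := fun k => by positivity
    have hBW : BoundedMeasurableOn (W (j + 1)) s :=
      BoundedMeasurableOn.mono ⟨hmeas _, _, hbound (j + 1)⟩ hs.2
    have hBF : ∀ k ∈ Finset.range n, BoundedMeasurableOn
        (fun r => a (j + 1 + k) / Real.Gamma (α * k + 1) * r ^ (α * k)) s := fun k _ =>
      boundedMeasurableOn_const_mul_rpow (hαn k) _
    -- I^α sends the k-th term of level j+1 to the (k+1)-st term of level j, and a j supplies the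
    -- missing term k = 0.
    have hrl : W j s - ∑ k ∈ Finset.range (n + 1),
          a (j + k) / Real.Gamma (α * k + 1) * s ^ (α * k) =
        rlIntegral α (fun r => W (j + 1) r - ∑ k ∈ Finset.range n,
          a (j + 1 + k) / Real.Gamma (α * k + 1) * r ^ (α * k)) s := by
      rw [rlIntegral_sub hα hs.1 hBW (boundedMeasurableOn_sum _ hBF), rlIntegral_sum hα hs.1 _ hBF,
        Finset.sum_range_succ', heq j s hs]
      have : ∀ k ∈ Finset.range n,
          rlIntegral α (fun r => a (j + 1 + k) / Real.Gamma (α * k + 1) * r ^ (α * k)) s =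
          a (j + (k + 1)) / Real.Gamma (α * ((k + 1 : ℕ) : ℝ) + 1) *
            s ^ (α * ((k + 1 : ℕ) : ℝ)) := fun k _ => by
        have hG := Gamma_mul_nat_add_one_pos hα.le k
        rw [rlIntegral_const_mul, rlIntegral_rpow hα hs.1 (hαn k), add_assoc j 1 k, add_comm 1 k]
        push_cast
        rw [mul_add, mul_one]
        field_simp
      rw [Finset.sum_congr rfl this]
      simp only [Nat.cast_zero, mul_zero, zero_add, Real.Gamma_one, div_one, Real.rpow_zero,
        mul_one, add_zero]
      ring
    rw [hrl]
    have hG := Gamma_mul_nat_add_one_pos hα.le n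
    refine (abs_rlIntegral_le hα hs.1 (hαn n) fun r hr => ih (j + 1) r
      ⟨hr.1, hr.2.trans hs.2⟩).trans (le_of_eq ?_)
    push_cast
    rw [mul_add, mul_one, show j + 1 + n = j + (n + 1) by ring]
    field_simp

/-- The Picard remainder is at most C (R s^α)ⁿ/Γ(αn+1), a term of a convergent Mittag-Leffler
series. -/
theorem tendsto_sum_of_hierarchy (hα : 0 < α) {T C R : ℝ} {W : ℕ → ℝ → ℝ}
    {a : ℕ → ℝ} (hmeas : ∀ j, AEStronglyMeasurable (W j) (volume.restrict (Set.Ioc 0 T)))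
    (hbound : ∀ j, ∀ s ∈ Set.Ioc 0 T, |W j s| ≤ C * R ^ j)
    (heq : ∀ j, ∀ s ∈ Set.Ioc 0 T, W j s = a j + rlIntegral α (W (j + 1)) s)
    {s : ℝ} (hs : s ∈ Set.Ioc 0 T) :
    Tendsto (fun n : ℕ => ∑ k ∈ Finset.range n,
      (s ^ α) ^ k / Real.Gamma (α * k + 1) * a k) atTop (𝓝 (W 0 s)) := by
  have hpow : ∀ n : ℕ, s ^ (α * n) = (s ^ α) ^ n := fun n => by
    rw [Real.rpow_mul hs.1.le, Real.rpow_natCast]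
  have h1 := (tendsto_pow_div_Gamma hα (R * s ^ α)).const_mul C
  rw [mul_zero] at h1
  rw [tendsto_iff_norm_sub_tendsto_zero]
  refine squeeze_zero (fun n => norm_nonneg _) (fun n => ?_) h1
  have h2 := abs_sub_sum_le_of_hierarchy hα hmeas hbound heq n 0 s hs
  rw [← Real.norm_eq_abs, norm_sub_rev] at h2
  refine le_trans (le_of_eq ?_) (h2.trans (le_of_eq ?_))
  · congr 2
    refine Finset.sum_congr rfl fun k _ => ?_
    rw [hpow, zero_add]
    ring
  · rw [hpow, zero_add, mul_pow]
    ring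

end RiemannLiouville

/-! ### Pairing L^p functions with Schwartz functions -/

section RePairing

variable {V : Type*} [NormedAddCommGroup V] [InnerProductSpace ℝ V] [FiniteDimensional ℝ V]
  [MeasurableSpace V] [BorelSpace V]

/-- The pairing of a real function with the real part of a Schwartz function. -/
noncomputable def rePairing (f : V → ℝ) (ψ : SchwartzMap V ℂ) : ℝ := ∫ x, f x * (ψ x).re

variable {p q : ℝ≥0∞} [hpq : ENNReal.HolderConjugate p q] {f g : V → ℝ}

include hpq in
theorem integrable_mul_schwartz_re (hf : MemLp f p volume) (ψ : SchwartzMap V ℂ) :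
    Integrable (fun x => f x * (ψ x).re) :=
  MemLp.integrable_mul (p := p) (q := q) hf (ψ.memLp q volume).re

theorem lintegral_enorm_mul_schwartz_le (hf : MemLp f p volume) (ψ : SchwartzMap V ℂ) :
    ∫⁻ x, ‖f x‖ₑ * ‖ψ x‖ₑ ≤ eLpNorm f p volume * eLpNorm ψ q volume := by
  have h := eLpNorm_smul_le_mul_eLpNorm (p := p) (q := q) (r := 1) (φ := f)
    (ψ.memLp q volume).1 hf.1
  rw [eLpNorm_one_eq_lintegral_enorm] at h
  refine le_trans (le_of_eq (lintegral_congr fun x => ?_)) h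
  rw [Pi.smul_apply', enorm_smul]

theorem abs_rePairing_le (hf : MemLp f p volume) (ψ : SchwartzMap V ℂ) :
    |rePairing f ψ| ≤ (eLpNorm f p volume).toReal * ‖ψ.toLp q volume‖ := by
  rw [SchwartzMap.norm_toLp, ← ENNReal.toReal_mul, ← ENNReal.ofReal_le_ofReal_iff
    ENNReal.toReal_nonneg, ENNReal.ofReal_toReal (ENNReal.mul_ne_top hf.2.ne
      (ψ.eLpNorm_lt_top q volume).ne), ← Real.enorm_eq_ofReal_abs]
  refine (enorm_integral_le_lintegral_enorm _).trans
    (le_trans (lintegral_mono fun x => ?_) (lintegral_enorm_mul_schwartz_le hf ψ))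
  rw [enorm_mul]
  gcongr
  rw [← ofReal_norm, ← ofReal_norm]
  exact ENNReal.ofReal_le_ofReal (Complex.abs_re_le_norm _)

include hpq in
theorem rePairing_sub_right (hf : MemLp f p volume) (ψ φ : SchwartzMap V ℂ) :
    rePairing f (ψ - φ) = rePairing f ψ - rePairing f φ := by
  unfold rePairing
  rw [← integral_sub (integrable_mul_schwartz_re (q := q) hf ψ)
    (integrable_mul_schwartz_re (q := q) hf φ)]
  simp [mul_sub]

include hpq in
theorem rePairing_sub_left (hf : MemLp f p volume) (hg : MemLp g p volume)
    (ψ : SchwartzMap V ℂ) :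
    rePairing (f - g) ψ = rePairing f ψ - rePairing g ψ := by
  unfold rePairing
  rw [← integral_sub (integrable_mul_schwartz_re (q := q) hf ψ)
    (integrable_mul_schwartz_re (q := q) hg ψ)]
  simp [sub_mul]

include hpq in
theorem tendsto_rePairing (hf : MemLp f p volume) (hq : 1 ≤ q) {u : ℕ → SchwartzMap V ℂ}
    {ψ : SchwartzMap V ℂ} (hu : Tendsto u atTop (𝓝 ψ)) :
    Tendsto (fun n => rePairing f (u n)) atTop (𝓝 (rePairing f ψ)) := by
  have := Fact.mk hq
  have h1 : Tendsto (fun n => (eLpNorm f p volume).toReal * ‖(u n - ψ).toLp q volume‖) atTop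
      (𝓝 0) := by
    have h2 := ((SchwartzMap.continuous_toLp (E := V) (F := ℂ) (p := q)
      (μ := volume)).norm.tendsto 0).comp
      ((tendsto_sub_nhds_zero_iff (x := ψ)).2 hu)
    have h3 : ‖(0 : SchwartzMap V ℂ).toLp q volume‖ = 0 := by
      rw [← SchwartzMap.toLpCLM_apply (𝕜 := ℝ), map_zero, norm_zero]
    rw [h3] at h2
    simpa using h2.const_mul (eLpNorm f p volume).toReal
  rw [tendsto_iff_norm_sub_tendsto_zero]
  refine squeeze_zero (fun n => norm_nonneg _) (fun n => ?_) h1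
  rw [← rePairing_sub_right (q := q) hf, Real.norm_eq_abs]
  exact abs_rePairing_le hf _

end RePairing

/-! ### The time-integrated equation -/

section Solution

variable {N : ℕ} {α : ℝ} {p q : ℝ≥0∞} [hpq : ENNReal.HolderConjugate p q]
  {u₀ : EuclideanSpace ℝ (Fin N) → ℝ} {u : ℝ → EuclideanSpace ℝ (Fin N) → ℝ}

theorem laplacian_re_schwartz (ψ : SchwartzMap (EuclideanSpace ℝ (Fin N)) ℂ) :
    Δ (fun x => (ψ x).re) = fun x => ((Δ ψ) x).re := by
  ext x
  have h := ((ψ.smooth 2).contDiffAt (x := x)).laplacian_CLM_comp_left (l := Complex.reCLM)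
  rw [SchwartzMap.laplacian_apply]
  exact h

theorem contDiff_schwartz_re (ψ : SchwartzMap (EuclideanSpace ℝ (Fin N)) ℂ) :
    ContDiff ℝ ∞ (fun x => (ψ x).re) :=
  Complex.reCLM.contDiff.comp (ψ.smooth ⊤)

theorem IsSolution.exists_abs_rePairing_le (hu : IsSolution α p u₀ u) (T : ℝ) :
    ∃ C : ℝ, 0 ≤ C ∧ ∀ (ψ : SchwartzMap (EuclideanSpace ℝ (Fin N)) ℂ), ∀ s ∈ Set.Ioc 0 T,
      |rePairing (u s) ψ| ≤ C * ‖ψ.toLp q volume‖ := by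
  obtain ⟨C, hC⟩ := hu.locallyBounded T
  refine ⟨C, C.2, fun ψ s hs => (abs_rePairing_le (q := q) (hu.memLp s hs.1) ψ).trans ?_⟩
  exact mul_le_mul_of_nonneg_right (ENNReal.toReal_le_coe_of_le_coe (hC s hs.1 hs.2))
    (by rw [SchwartzMap.norm_toLp]; exact ENNReal.toReal_nonneg)

theorem IsSolution.continuousOn_rePairing (hu : IsSolution α p u₀ u)
    {ψ : SchwartzMap (EuclideanSpace ℝ (Fin N)) ℂ} (hψ : HasCompactSupport ψ) :
    ContinuousOn (fun s => rePairing (u s) ψ) (Set.Ioi 0) := fun s hs => by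
  obtain ⟨d, hd, -⟩ := hu.equation _ (contDiff_schwartz_re ψ) (hψ.comp_left Complex.zero_re) s hs
  exact hd.continuousAt.continuousWithinAt

-- The equation gives continuity in time only for compactly supported tests; for Schwartz tests,
-- measurability survives as a pointwise limit.
include hpq in
theorem IsSolution.boundedMeasurableOn_rePairing (hu : IsSolution α p u₀ u) (hq : 1 ≤ q)
    (ψ : SchwartzMap (EuclideanSpace ℝ (Fin N)) ℂ) (t : ℝ) :
    BoundedMeasurableOn (fun s => rePairing (u s) ψ) t := by
  constructor
  · obtain ⟨v, hv, hlim⟩ := ψ.exists_seq_hasCompactSupport_tendsto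
    refine aestronglyMeasurable_of_tendsto_ae atTop (f := fun n s => rePairing (u s) (v n))
      (fun n => ?_) ?_
    · exact ((hu.continuousOn_rePairing (hv n)).mono Set.Ioc_subset_Ioi_self).aestronglyMeasurable
        measurableSet_Ioc
    · filter_upwards [ae_restrict_mem measurableSet_Ioc] with s hs
      exact tendsto_rePairing (q := q) (hu.memLp s hs.1) hq hlim
  · obtain ⟨C, -, hC⟩ := hu.exists_abs_rePairing_le (q := q) t
    exact ⟨_, hC ψ⟩

include hpq in
/-- A solution satisfies the time-integrated equation, tested against compactly supported
functions. -/
theorem IsSolution.rePairing_eq_of_hasCompactSupport (hu : IsSolution α p u₀ u) (hα : 0 < α)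
    {ψ : SchwartzMap (EuclideanSpace ℝ (Fin N)) ℂ} (hψ : HasCompactSupport ψ)
    {t : ℝ} (ht : 0 < t) :
    rePairing (u t) ψ = rePairing u₀ ψ + rlIntegral α (fun s => rePairing (u s) (Δ ψ)) t := by
  have hc : HasCompactSupport (fun x => (ψ x).re) := hψ.comp_left Complex.zero_re
  -- The equation says D' = 0 on (0,∞), as the derivative of order 1-α differentiates I^α. Since I^α
  -- of a bounded function is O(s^α), the constant D is its limit at 0, the initial pairing.
  set D : ℝ → ℝ := fun s =>
    rePairing (u s) ψ - rlIntegral α (fun s => rePairing (u s) (Δ ψ)) s with hD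
  have hderiv : ∀ s ∈ Set.Ioi (0 : ℝ), HasDerivAt D 0 s := fun s hs => by
    obtain ⟨d, hd1, hd2⟩ := hu.equation _ (contDiff_schwartz_re ψ) hc s hs
    unfold HasRLDerivAt at hd2
    rw [sub_sub_cancel, laplacian_re_schwartz] at hd2
    have := hd1.sub hd2
    rwa [sub_self] at this
  have hconst : ∀ s ∈ Set.Ioi (0 : ℝ), D s = D t := fun s hs =>
    isOpen_Ioi.is_const_of_deriv_eq_zero isPreconnected_Ioi
      (fun r hr => (hderiv r hr).differentiableAt.differentiableWithinAt)
      (fun r hr => (hderiv r hr).deriv) hs ht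
  have hlim1 : Tendsto (fun s => rlIntegral α (fun s => rePairing (u s) (Δ ψ)) s) (𝓝[>] 0)
      (𝓝 0) := by
    obtain ⟨C, -, hC⟩ := hu.exists_abs_rePairing_le (q := q) 1
    have h1 : Tendsto (fun s : ℝ => C * ‖(Δ ψ : SchwartzMap _ ℂ).toLp q volume‖ *
        (Real.Gamma (0 + 1) / Real.Gamma (0 + α + 1) * s ^ (0 + α))) (𝓝[>] 0) (𝓝 0) := by
      have h2 : Tendsto (fun s : ℝ => s ^ (0 + α)) (𝓝[>] 0) (𝓝 0) := by
        have := (Real.continuousAt_rpow_const 0 (0 + α) (Or.inr (by linarith))).tendsto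
        rw [Real.zero_rpow (by linarith)] at this
        exact this.mono_left nhdsWithin_le_nhds
      simpa using (h2.const_mul _).const_mul _
    refine squeeze_zero_norm' ?_ h1
    filter_upwards [Ioc_mem_nhdsGT (zero_lt_one (α := ℝ))] with s hs
    refine abs_rlIntegral_le hα hs.1 le_rfl fun r hr => ?_
    rw [Real.rpow_zero, mul_one]
    exact hC _ r ⟨hr.1, hr.2.trans hs.2⟩
  have hlim2 : Tendsto D (𝓝[>] 0) (𝓝 (rePairing u₀ ψ)) := by
    have := (hu.initial _ (contDiff_schwartz_re ψ) hc).sub hlim1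
    rwa [sub_zero] at this
  have hlim3 : Tendsto D (𝓝[>] 0) (𝓝 (D t)) :=
    tendsto_const_nhds.congr' (by
      filter_upwards [self_mem_nhdsWithin] with s hs using (hconst s hs).symm)
  rw [tendsto_nhds_unique hlim2 hlim3, hD]
  ring

-- Bandlimited tests need not have compact support, so the identity is extended by density.
-- Convergence of Δ(v n) in L^q bounds its norms, giving the dominating function (t-s)^(α-1) C B.
include hpq in
theorem IsSolution.rePairing_eq (hu : IsSolution α p u₀ u) (hu₀ : MemLp u₀ p volume) (hα : 0 < α)
    (hq : 1 ≤ q) (ψ : SchwartzMap (EuclideanSpace ℝ (Fin N)) ℂ) {t : ℝ} (ht : 0 < t) :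
    rePairing (u t) ψ = rePairing u₀ ψ + rlIntegral α (fun s => rePairing (u s) (Δ ψ)) t := by
  have := Fact.mk hq
  obtain ⟨v, hv, hlim⟩ := ψ.exists_seq_hasCompactSupport_tendsto
  have hlimΔ : Tendsto (fun n => (Δ (v n) : SchwartzMap (EuclideanSpace ℝ (Fin N)) ℂ)) atTop
      (𝓝 (Δ ψ)) :=
    ((LineDeriv.laplacianCLM ℝ (EuclideanSpace ℝ (Fin N))
      (SchwartzMap (EuclideanSpace ℝ (Fin N)) ℂ)).continuous.tendsto ψ).comp hlim
  obtain ⟨C, hC0, hC⟩ := hu.exists_abs_rePairing_le (q := q) t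
  obtain ⟨B, hB⟩ := ((SchwartzMap.continuous_toLp (F := ℂ) (p := q)
    (μ := (volume : Measure (EuclideanSpace ℝ (Fin N))))).norm.tendsto (Δ ψ)).comp hlimΔ
    |>.bddAbove_range
  have hrl : Tendsto (fun n => rlIntegral α (fun s => rePairing (u s) (Δ (v n))) t) atTop
      (𝓝 (rlIntegral α (fun s => rePairing (u s) (Δ ψ)) t)) := by
    unfold rlIntegral
    refine Tendsto.const_mul _ ?_
    refine intervalIntegral.tendsto_integral_filter_of_dominated_convergence
      (fun s => (t - s) ^ (α - 1) * (C * B)) (Eventually.of_forall fun n => ?_)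
      (Eventually.of_forall fun n => ae_of_all _ fun s hs => ?_)
      ((intervalIntegrable_sub_rpow hα t).mul_const _) (ae_of_all _ fun s hs => ?_)
    · have := (hu.boundedMeasurableOn_rePairing hq (Δ (v n)) t).1
      rw [Set.uIoc_of_le ht.le]
      exact AEStronglyMeasurable.mul
        ((measurable_const.sub measurable_id).pow_const _).aestronglyMeasurable this
    · rw [Set.uIoc_of_le ht.le] at hs
      have h0 : 0 ≤ (t - s) ^ (α - 1) := Real.rpow_nonneg (by linarith [hs.2]) _
      rw [norm_mul, Real.norm_of_nonneg h0]
      gcongr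
      refine (hC _ s hs).trans ?_
      gcongr
      exact hB ⟨n, rfl⟩
    · rw [Set.uIoc_of_le ht.le] at hs
      exact (tendsto_rePairing (q := q) (hu.memLp s hs.1) hq hlimΔ).const_mul _
  refine tendsto_nhds_unique (tendsto_rePairing (q := q) (hu.memLp t ht) hq hlim) ?_
  refine ((tendsto_rePairing (q := q) hu₀ hq hlim).add hrl).congr fun n => ?_
  exact (hu.rePairing_eq_of_hasCompactSupport (q := q) hα (hv n) ht).symm

end Solution

/-! ### Bandlimited functions separate L^p -/

section Density

open FourierTransform

variable {V : Type*} [NormedAddCommGroup V] [InnerProductSpace ℝ V] [FiniteDimensional ℝ V]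
  [MeasurableSpace V] [BorelSpace V] {p q : ℝ≥0∞} [hpq : ENNReal.HolderConjugate p q]

include hpq in
/-- An `L^p` function annihilating all bandlimited Schwartz functions vanishes. -/
theorem ae_eq_zero_of_rePairing_bandlimited {f : V → ℝ} (hf : MemLp f p volume) (hp : 1 ≤ p)
    (hq : 1 ≤ q) (h : ∀ ψ : SchwartzMap V ℂ, HasCompactSupport (𝓕 ψ : SchwartzMap V ℂ) →
      rePairing f ψ = 0) : ∀ᵐ x, f x = 0 := by
  have hall : ∀ ψ : SchwartzMap V ℂ, rePairing f ψ = 0 := fun ψ => by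
    -- Cutting off on the Fourier side and transforming back approximates ψ by bandlimited functions
    -- in the Schwartz topology.
    obtain ⟨v, hv, hlim⟩ := (𝓕 ψ : SchwartzMap V ℂ).exists_seq_hasCompactSupport_tendsto
    have h1 : Tendsto (fun n => (𝓕⁻ (v n) : SchwartzMap V ℂ)) atTop (𝓝 ψ) := by
      have h2 := ((FourierTransform.fourierCLE ℂ (SchwartzMap V ℂ)).symm.continuous.tendsto
        (𝓕 ψ)).comp hlim
      simpa only [Function.comp_def, FourierTransform.fourierCLE_symm_apply,
        FourierTransform.fourierInv_fourier_eq] using h2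
    refine tendsto_nhds_unique (tendsto_rePairing (q := q) hf hq h1) ?_
    refine tendsto_const_nhds.congr fun n => (h _ ?_).symm
    rw [FourierTransform.fourier_fourierInv_eq]
    exact hv n
  refine ae_eq_zero_of_integral_contDiff_smul_eq_zero (hf.locallyIntegrable hp) fun g hg hgc => ?_
  have hgs : ContDiff ℝ ∞ (fun x => (g x : ℂ)) := Complex.ofRealCLM.contDiff.comp hg
  have hgc' : HasCompactSupport (fun x => (g x : ℂ)) := hgc.comp_left Complex.ofReal_zero
  have := hall (hgc'.toSchwartzMap hgs)
  simpa [rePairing, mul_comm] using this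

end Density

/-! ### Convolution with an integrable kernel -/

section GreenConvolution

variable {V : Type*} [NormedAddCommGroup V] [InnerProductSpace ℝ V] [FiniteDimensional ℝ V]
  [MeasurableSpace V] [BorelSpace V] {p q : ℝ≥0∞} [hpq : ENNReal.HolderConjugate p q]
  {G f : V → ℝ}

-- Translations preserve the L^p norm, so for fixed y Hölder's inequality bounds the x-integral by
-- |G(y)| ‖f‖_p ‖ψ‖_q.
include hpq in
theorem integrable_prod_mul_mul_schwartz (hG : Integrable G) (hf : MemLp f p volume)
    (ψ : SchwartzMap V ℂ) :
    Integrable (fun z : V × V => G z.2 * f (z.1 - z.2) * (ψ z.1).re) (volume.prod volume) := by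
  have hψm : Measurable fun x : V => (ψ x).re :=
    (Complex.continuous_re.comp ψ.continuous).measurable
  have hmeas : AEStronglyMeasurable (fun z : V × V => G z.2 * f (z.1 - z.2) * (ψ z.1).re)
      (volume.prod volume) :=
    (hG.1.comp_snd.mul (hf.1.comp_quasiMeasurePreserving
      (quasiMeasurePreserving_sub volume volume))).mul
      (hψm.comp measurable_fst).aestronglyMeasurable
  have hfy : ∀ y : V, MemLp (fun x => f (x - y)) p volume := fun y =>
    hf.comp_measurePreserving (measurePreserving_sub_right volume y)
  have hnorm : ∀ y : V, eLpNorm (fun x => f (x - y)) p volume = eLpNorm f p volume := fun y =>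
    eLpNorm_comp_measurePreserving hf.1 (measurePreserving_sub_right volume y)
  rw [integrable_prod_iff' hmeas]
  constructor
  · refine ae_of_all _ fun y => ?_
    simp_rw [mul_assoc]
    exact (integrable_mul_schwartz_re (q := q) (hfy y) ψ).const_mul _
  · refine Integrable.mono' (hG.norm.mul_const
      (eLpNorm f p volume * eLpNorm ψ q volume).toReal)
      hmeas.norm.prod_swap.integral_prod_right' (ae_of_all _ fun y => ?_)
    have h1 : ∀ x, ‖G y * f (x - y) * (ψ x).re‖ = ‖G y‖ * ‖f (x - y) * (ψ x).re‖ := fun x => by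
      rw [mul_assoc, norm_mul]
    rw [Real.norm_of_nonneg (integral_nonneg fun _ => norm_nonneg _)]
    simp only [h1]
    rw [integral_const_mul]
    gcongr
    have hfin : eLpNorm f p volume * eLpNorm ψ q volume ≠ ⊤ :=
      ENNReal.mul_ne_top hf.2.ne (ψ.eLpNorm_lt_top q volume).ne
    rw [← ENNReal.ofReal_le_iff_le_toReal hfin, ofReal_integral_norm_eq_lintegral_enorm
      (integrable_mul_schwartz_re (q := q) (hfy y) ψ), ← hnorm y]
    refine (lintegral_mono fun x => ?_).trans (lintegral_enorm_mul_schwartz_le (hfy y) ψ)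
    rw [enorm_mul]
    gcongr
    rw [← ofReal_norm, ← ofReal_norm]
    exact ENNReal.ofReal_le_ofReal (Complex.abs_re_le_norm _)

include hpq in
/-- Moving the convolution with `G` onto the test function. -/
theorem integral_mul_integral_eq_rePairing (hG : Integrable G) (hf : MemLp f p volume)
    (ψ : SchwartzMap V ℂ) :
    Integrable (fun x => f x * ∫ y, G y * (ψ (x + y)).re) ∧
      ∫ x, f x * ∫ y, G y * (ψ (x + y)).re =
        rePairing (fun x => ∫ y, G y * f (x - y)) ψ := by
  have h1 := integrable_prod_mul_mul_schwartz (q := q) hG hf ψ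
  -- This shear carries the integrand with f translated to the one with ψ translated.
  have hT : MeasurePreserving (fun z : V × V => (z.1 + z.2, z.2))
      (volume.prod volume) (volume.prod volume) := by
    have h := (measurePreserving_add_prod (volume : Measure V) (volume : Measure V))
    exact h
  have h2 : Integrable (fun z : V × V => f z.1 * (G z.2 * (ψ (z.1 + z.2)).re))
      (volume.prod volume) := by
    refine (hT.integrable_comp_of_integrable h1).congr (ae_of_all _ fun z => ?_)
    simp only [Function.comp_apply, add_sub_cancel_right]
    ring
  have h3 : ∀ x, f x * ∫ y, G y * (ψ (x + y)).re =
      ∫ y, f x * (G y * (ψ (x + y)).re) := fun x => (integral_const_mul _ _).symm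
  refine ⟨?_, ?_⟩
  · simp_rw [h3]
    exact h2.integral_prod_left
  · simp_rw [h3]
    rw [integral_integral_swap h2]
    have h4 : ∀ y, ∫ x, f x * (G y * (ψ (x + y)).re) =
        ∫ x, G y * f (x - y) * (ψ x).re := fun y => by
      rw [← integral_add_right_eq_self (fun x => G y * f (x - y) * (ψ x).re) y]
      refine integral_congr_ae (ae_of_all _ fun x => ?_)
      simp only [add_sub_cancel_right]
      ring
    simp_rw [h4]
    rw [← integral_integral_swap h1]
    simp_rw [integral_mul_const]
    rfl

theorem eLpNorm_integral_mul_sub_le (hG : Integrable G) (hf : MemLp f p volume) (hp : 1 ≤ p) :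
    eLpNorm (fun x => ∫ y, G y * f (x - y)) p volume ≤
      eLpNorm G 1 volume * eLpNorm f p volume := by
  refine eLpNorm_le_of_enorm_le_lintegral_mul_sub hG.1 hf.1 hp fun x => ?_
  refine (enorm_integral_le_lintegral_enorm _).trans (le_of_eq ?_)
  simp [enorm_mul]

theorem memLp_integral_mul_sub (hG : Integrable G) (hf : MemLp f p volume) (hp : 1 ≤ p) :
    MemLp (fun x => ∫ y, G y * f (x - y)) p volume := by
  refine ⟨?_, (eLpNorm_integral_mul_sub_le hG hf hp).trans_lt
    (ENNReal.mul_lt_top (memLp_one_iff_integrable.2 hG).2 hf.2)⟩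
  exact AEStronglyMeasurable.integral_prod_right' (f := fun z : V × V => G z.2 * f (z.1 - z.2))
    (hG.1.comp_snd.mul (hf.1.comp_quasiMeasurePreserving
      (quasiMeasurePreserving_sub volume volume)))

end GreenConvolution

/-! ### Every solution is the Green convolution of its datum -/

section Representation

open FourierTransform

variable {N : ℕ} {α : ℝ} {p q : ℝ≥0∞} [hpq : ENNReal.HolderConjugate p q]
  {u₀ : EuclideanSpace ℝ (Fin N) → ℝ} {u : ℝ → EuclideanSpace ℝ (Fin N) → ℝ}
  {M : Measure ℝ} [IsProbabilityMeasure M]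

-- Both sides are the sum of (t^α)ⁿ/Γ(αn+1) ⟨u₀,Δⁿψ⟩: the left by Picard iteration, the right by
-- integrating the power series of the Green average against u₀ term by term.
include hpq in
theorem IsSolution.rePairing_eq_integral_green (hu : IsSolution α p u₀ u)
    (hu₀ : MemLp u₀ p volume) (hα : 0 < α) (hq : 1 ≤ q) (hM : ∀ᵐ m ∂M, 0 < m)
    (hml : ∀ x : ℝ, mittagLeffler α x = ((∫ m, Real.exp (x * m) ∂M : ℝ) : ℂ))
    {ψ : SchwartzMap (EuclideanSpace ℝ (Fin N)) ℂ}
    (hψ : HasCompactSupport (𝓕 ψ : SchwartzMap (EuclideanSpace ℝ (Fin N)) ℂ))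
    {t : ℝ} (ht : 0 < t) :
    rePairing (u t) ψ =
      ∫ x, u₀ x * ∫ y, subordinatedKernel M (t ^ α) y * (ψ (x + y)).re := by
  have hc : 0 < t ^ α := by positivity
  have hG : Integrable (subordinatedKernel M (t ^ α) : EuclideanSpace ℝ (Fin N) → ℝ) :=
    integrable_subordinatedKernel hM hc
  obtain ⟨R, hR⟩ := exists_eLpNorm_iteratedLaplacian_le hψ hq
  have hRn : ∀ n, ‖(iteratedLaplacian n ψ).toLp q volume‖ ≤
      (R : ℝ) ^ n * ‖ψ.toLp q volume‖ := fun n => by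
    rw [SchwartzMap.norm_toLp, SchwartzMap.norm_toLp]
    have h := ENNReal.toReal_mono (ENNReal.mul_ne_top (by simp)
      (ψ.eLpNorm_lt_top q volume).ne) (hR n)
    simpa using h
  have hB0 : 0 ≤ ‖ψ.toLp q volume‖ := by
    rw [SchwartzMap.norm_toLp]
    exact ENNReal.toReal_nonneg
  obtain ⟨C, hC0, hC⟩ := hu.exists_abs_rePairing_le (q := q) t
  have hlim := tendsto_sum_of_hierarchy hα (T := t) (C := C * ‖ψ.toLp q volume‖) (R := R)
    (W := fun j s => rePairing (u s) (iteratedLaplacian j ψ))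
    (a := fun j => rePairing u₀ (iteratedLaplacian j ψ))
    (fun j => (hu.boundedMeasurableOn_rePairing hq _ t).1)
    (fun j s hs => (hC _ s hs).trans (by
      rw [mul_assoc, mul_comm ‖ψ.toLp q volume‖]
      exact mul_le_mul_of_nonneg_left (hRn j) hC0))
    (fun j s hs => by
      rw [iteratedLaplacian_succ]
      exact hu.rePairing_eq hu₀ hα hq _ hs.1)
    (Set.right_mem_Ioc.2 ht)
  refine tendsto_nhds_unique hlim ?_
  have hint : ∀ n : ℕ, Integrable (fun x => (t ^ α) ^ n / Real.Gamma (α * n + 1) *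
      (u₀ x * (iteratedLaplacian n ψ x).re)) := fun n =>
    (integrable_mul_schwartz_re (q := q) hu₀ _).const_mul _
  have hsum : Summable fun n : ℕ => ∫ x, ‖(t ^ α) ^ n / Real.Gamma (α * n + 1) *
      (u₀ x * (iteratedLaplacian n ψ x).re)‖ := by
    refine Summable.of_nonneg_of_le (fun n => integral_nonneg fun _ => norm_nonneg _)
      (fun n => ?_) ((summable_pow_div_Gamma hα (R * t ^ α)).mul_right
        ((eLpNorm u₀ p volume).toReal * ‖ψ.toLp q volume‖))
    have hΓ := Gamma_mul_nat_add_one_pos hα.le n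
    simp only [norm_mul ((t ^ α) ^ n / Real.Gamma (α * n + 1))]
    rw [integral_const_mul, Real.norm_of_nonneg (by positivity), mul_pow]
    have h1 : ∫ x, ‖u₀ x * (iteratedLaplacian n ψ x).re‖ ≤
        (eLpNorm u₀ p volume).toReal * ‖(iteratedLaplacian n ψ).toLp q volume‖ := by
      rw [SchwartzMap.norm_toLp, ← ENNReal.toReal_mul, ← ENNReal.ofReal_le_iff_le_toReal
        (ENNReal.mul_ne_top hu₀.2.ne (SchwartzMap.eLpNorm_lt_top _ q volume).ne),
        ofReal_integral_norm_eq_lintegral_enorm (integrable_mul_schwartz_re (q := q) hu₀ _)]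
      refine (lintegral_mono fun x => ?_).trans (lintegral_enorm_mul_schwartz_le hu₀ _)
      rw [enorm_mul]
      gcongr
      rw [← ofReal_norm, ← ofReal_norm]
      exact ENNReal.ofReal_le_ofReal (Complex.abs_re_le_norm _)
    calc (t ^ α) ^ n / Real.Gamma (α * n + 1) * ∫ x, ‖u₀ x * (iteratedLaplacian n ψ x).re‖
        ≤ (t ^ α) ^ n / Real.Gamma (α * n + 1) *
          ((eLpNorm u₀ p volume).toReal * ((R : ℝ) ^ n * ‖ψ.toLp q volume‖)) := by
          refine mul_le_mul_of_nonneg_left (h1.trans ?_) (by positivity)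
          exact mul_le_mul_of_nonneg_left (hRn n) ENNReal.toReal_nonneg
      _ = _ := by ring
  have hhas := hasSum_integral_of_summable_integral_norm hint hsum
  have hpt : ∀ x, ∑' n : ℕ, (t ^ α) ^ n / Real.Gamma (α * n + 1) *
      (u₀ x * (iteratedLaplacian n ψ x).re) =
      u₀ x * ∫ y, subordinatedKernel M (t ^ α) y * (ψ (x + y)).re := fun x => by
    have h1 := Complex.hasSum_re (hasSum_iteratedLaplacian_div_Gamma hM hα hc hml hψ x)
    have h2 : Integrable fun y => (subordinatedKernel M (t ^ α) y : ℂ) * ψ (x + y) := by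
      refine hG.ofReal.mul_bdd (c := SchwartzMap.seminorm ℝ 0 0 ψ)
        (ψ.continuous.comp (continuous_const_add x)).aestronglyMeasurable
        (ae_of_all _ fun y => SchwartzMap.norm_le_seminorm ℝ ψ _)
    have h3 : (∫ y, (subordinatedKernel M (t ^ α) y : ℂ) * ψ (x + y)).re =
        ∫ y, subordinatedKernel M (t ^ α) y * (ψ (x + y)).re := by
      have := integral_re h2
      simp only [RCLike.re_to_complex, Complex.re_ofReal_mul] at this
      exact this.symm
    rw [h3] at h1
    simp only [Complex.re_ofReal_mul] at h1
    rw [← (h1.mul_left (u₀ x)).tsum_eq]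
    exact tsum_congr fun n => by ring
  simp only [hpt] at hhas
  refine hhas.tendsto_sum_nat.congr fun n => Finset.sum_congr rfl fun k _ => ?_
  rw [integral_const_mul]
  rfl

/-- The difference of two solutions is the convolution of the Green function with the difference of
the initial data. -/
theorem IsSolution.sub_ae_eq_green_convolution {v₀ : EuclideanSpace ℝ (Fin N) → ℝ}
    {v : ℝ → EuclideanSpace ℝ (Fin N) → ℝ} (hu : IsSolution α p u₀ u) (hv : IsSolution α p v₀ v)
    (hu₀ : MemLp u₀ p volume) (hv₀ : MemLp v₀ p volume) (hα : 0 < α) (hp : 1 ≤ p)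
    (hM : ∀ᵐ m ∂M, 0 < m)
    (hml : ∀ x : ℝ, mittagLeffler α x = ((∫ m, Real.exp (x * m) ∂M : ℝ) : ℂ))
    {t : ℝ} (ht : 0 < t) :
    u t - v t =ᵐ[volume] fun x => ∫ y, subordinatedKernel M (t ^ α) y * (u₀ - v₀) (x - y) := by
  have hpq := ENNReal.HolderConjugate.conjExponent hp
  set q := ENNReal.conjExponent p
  have hq : 1 ≤ q := ENNReal.HolderConjugate.one_le q p
  have hG : Integrable (subordinatedKernel M (t ^ α) : EuclideanSpace ℝ (Fin N) → ℝ) :=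
    integrable_subordinatedKernel hM (by positivity)
  have hconv := memLp_integral_mul_sub hG (hu₀.sub hv₀) hp
  have hdiff := (hu.memLp t ht).sub (hv.memLp t ht)
  have h := ae_eq_zero_of_rePairing_bandlimited (q := q) (hdiff.sub hconv) hp hq fun ψ hψ => by
    rw [rePairing_sub_left (q := q) hdiff hconv,
      rePairing_sub_left (q := q) (hu.memLp t ht) (hv.memLp t ht),
      hu.rePairing_eq_integral_green (q := q) hu₀ hα hq hM hml hψ ht,
      hv.rePairing_eq_integral_green (q := q) hv₀ hα hq hM hml hψ ht,
      ← (integral_mul_integral_eq_rePairing (q := q) hG (hu₀.sub hv₀) ψ).2,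
      ← integral_sub (integral_mul_integral_eq_rePairing (q := q) hG hu₀ ψ).1
        (integral_mul_integral_eq_rePairing (q := q) hG hv₀ ψ).1, sub_eq_zero]
    simp only [Pi.sub_apply, sub_mul]
  filter_upwards [h] with x hx
  exact sub_eq_zero.1 hx

end Representation

/-! ### The stability estimate -/

theorem mainTheorem8 (N : ℕ) (hN : 1 ≤ N) (α : ℝ) (hα0 : 0 < α) (hα1 : α < 1)
    (p : ℝ≥0∞) (hp : 1 ≤ p) :
    ∃ G : ℝ → EuclideanSpace ℝ (Fin N) → ℝ,
      (∀ t : ℝ, 0 < t → IsGreenFunction α t (G t)) ∧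
      (∀ (u₀₁ u₀₂ : EuclideanSpace ℝ (Fin N) → ℝ) (u₁ u₂ : ℝ → EuclideanSpace ℝ (Fin N) → ℝ),
        MemLp u₀₁ p volume → MemLp u₀₂ p volume →
        IsSolution α p u₀₁ u₁ → IsSolution α p u₀₂ u₂ →
        ∀ t : ℝ, 0 < t →
          eLpNorm (u₁ t - u₂ t) p volume
              ≤ eLpNorm (G t) 1 volume * eLpNorm (u₀₁ - u₀₂) p volume ∧
          eLpNorm (G t) 1 volume * eLpNorm (u₀₁ - u₀₂) p volume
              ≤ eLpNorm (u₀₁ - u₀₂) p volume) ∧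
      (∀ (u₀₁ : EuclideanSpace ℝ (Fin N) → ℝ) (u₁ : ℝ → EuclideanSpace ℝ (Fin N) → ℝ),
        MemLp u₀₁ p volume → IsSolution α p u₀₁ u₁ →
        ∀ ε : ℝ, 0 < ε → ∃ δ : ℝ, 0 < δ ∧
          ∀ (u₀₂ : EuclideanSpace ℝ (Fin N) → ℝ) (u₂ : ℝ → EuclideanSpace ℝ (Fin N) → ℝ),
            MemLp u₀₂ p volume → IsSolution α p u₀₂ u₂ →
            eLpNorm (u₀₁ - u₀₂) p volume < ENNReal.ofReal δ →
            ∀ t : ℝ, 0 < t → eLpNorm (u₁ t - u₂ t) p volume < ENNReal.ofReal ε) := by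
  obtain ⟨M, hMp, hM, hml⟩ := exists_measure_mittagLeffler_eq_integral_exp hα0 hα1
  have key : ∀ (u₀₁ u₀₂ : EuclideanSpace ℝ (Fin N) → ℝ)
      (u₁ u₂ : ℝ → EuclideanSpace ℝ (Fin N) → ℝ), MemLp u₀₁ p volume → MemLp u₀₂ p volume →
      IsSolution α p u₀₁ u₁ → IsSolution α p u₀₂ u₂ → ∀ t : ℝ, 0 < t →
      eLpNorm (u₁ t - u₂ t) p volume ≤
        eLpNorm (subordinatedKernel M (t ^ α) : EuclideanSpace ℝ (Fin N) → ℝ) 1 volume *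
          eLpNorm (u₀₁ - u₀₂) p volume := by
    intro u₀₁ u₀₂ u₁ u₂ h₀₁ h₀₂ h₁ h₂ t ht
    rw [eLpNorm_congr_ae (h₁.sub_ae_eq_green_convolution h₂ h₀₁ h₀₂ hα0 hp hM hml ht)]
    exact eLpNorm_integral_mul_sub_le (integrable_subordinatedKernel hM (by positivity))
      (h₀₁.sub h₀₂) hp
  have hone : ∀ t : ℝ, 0 < t →
      eLpNorm (subordinatedKernel M (t ^ α) : EuclideanSpace ℝ (Fin N) → ℝ) 1 volume = 1 :=
    fun t ht => eLpNorm_subordinatedKernel hM (by positivity)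
  refine ⟨fun t => subordinatedKernel M (t ^ α),
    fun t ht => isGreenFunction_subordinatedKernel hM ht hml, ?_, ?_⟩
  · intro u₀₁ u₀₂ u₁ u₂ h₀₁ h₀₂ h₁ h₂ t ht
    exact ⟨key u₀₁ u₀₂ u₁ u₂ h₀₁ h₀₂ h₁ h₂ t ht, by rw [hone t ht, one_mul]⟩
  · intro u₀₁ u₁ h₀₁ h₁ ε hε
    -- The solution map is nonexpansive uniformly in t, because ‖G(·,t)‖₁ = 1; hence δ = ε.
    refine ⟨ε, hε, fun u₀₂ u₂ h₀₂ h₂ hδ t ht => ?_⟩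
    refine lt_of_le_of_lt ?_ hδ
    have h := key u₀₁ u₀₂ u₁ u₂ h₀₁ h₀₂ h₁ h₂ t ht
    rwa [hone t ht, one_mul] at h
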